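/- For $a=(a_1,\ldots,a_n)\in\mathbb{R}^n$ and $x\in\mathbb{R}^n_+:=\{x\in\mathbb{R}^n : x_i>0 \text{ for all } i\}$ write $x^a:=x_1^{a_1}\cdots x_n^{a_n}$. An $n\times n$ fewnomial system of type $(m_1,\ldots,m_n)$, where all $m_i\geq 1$, is a tuple $F=(f_1,\ldots,f_n)$ in which $f_i$ is a linear combination of exactly $m_i$ distinct monomials $x^a$ (real exponent vectors $a\in\mathbb{R}^n$ allowed) with nonzero real coefficients. An arc is a point or a homeomorphic image of the unit circle or of an open, closed or half-open unit interval. A root $\zeta\in\mathbb{R}^n_+$ of $F$ is isolated if the only arc of roots of $F$ in $\mathbb{R}^n_+$ containing $\zeta$ is $\{\zeta\}$, and non-degenerate if the Jacobian matrix of $F$ at $\zeta$ has full rank. Let $\mathcal{N}(m_1,\ldots,m_n)$ (resp. $\mathcal{N}'(m_1,\ldots,m_n)$) denote the maximal number of isolated (resp. non-degenerate) roots in $\mathbb{R}^n_+$ of an $n\times n$ fewnomial system of type $(m_1,\ldots,m_n)$. **Theorem.** For all $m\geq 3$ we have $\mathcal{N}(3,m)\leq 2^m-2$; moreover $\mathcal{N}(3,3)=5$,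 $\mathcal{N}(3,4)\leq 14$ and $\mathcal{N}(3,5)\leq 30$. Furthermore, $\mathcal{N}'(3,m)=\mathcal{N}(3,m)$ for all $m\geq 3$. -/

import Mathlib

/-- A finite real linear combination of monomials `x ^ a`, `a ∈ ℝⁿ`, recorded by its coefficients:
`f a` is the coefficient of `x ^ a = x₁ ^ a₁ ⋯ xₙ ^ aₙ`. Its monomial terms are indexed by
`f.support`. -/
abbrev Fewnomial (n : ℕ) : Type := (Fin n → ℝ) →₀ ℝ

namespace Fewnomial

/-- The value `∑ₐ f a * x₁ ^ a₁ ⋯ xₙ ^ aₙ`; only used at points with positive coordinates. -/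
noncomputable def eval {n : ℕ} (f : Fewnomial n) (x : Fin n → ℝ) : ℝ :=
  ∑ a ∈ f.support, f a * ∏ i, x i ^ a i

/-- The open positive orthant of `ℝⁿ`. -/
def positiveOrthant (n : ℕ) : Set (Fin n → ℝ) := {x | ∀ i, 0 < x i}

/-- An `n × n` fewnomial system is of type `(m₁, …, mₙ)`, where all `mᵢ ≥ 1`, if its `i`-th member
has exactly `mᵢ` monomial terms. -/
def IsOfType {n : ℕ} (F : Fin n → Fewnomial n) (m : Fin n → ℕ) : Prop :=
  ∀ i, 1 ≤ m i ∧ (F i).support.card = m i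

/-- The set of roots of the system `F` in the positive orthant. -/
def roots {n : ℕ} (F : Fin n → Fewnomial n) : Set (Fin n → ℝ) :=
  {x | x ∈ positiveOrthant n ∧ ∀ i, (F i).eval x = 0}

/-- An arc: a point, or a homeomorphic image of the unit circle or of the
open, closed or half-open unit interval. -/
def IsArc {X : Type*} [TopologicalSpace X] (A : Set X) : Prop :=
  (∃ x, A = {x}) ∨
  Nonempty (Circle ≃ₜ A) ∨
  Nonempty (Set.Ioo (0 : ℝ) 1 ≃ₜ A) ∨
  Nonempty (Set.Icc (0 : ℝ) 1 ≃ₜ A) ∨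
  Nonempty (Set.Ico (0 : ℝ) 1 ≃ₜ A)

/-- A root is isolated if the only arc of roots containing it is the root itself. -/
def IsIsolatedRoot {n : ℕ} (F : Fin n → Fewnomial n) (z : Fin n → ℝ) : Prop :=
  z ∈ roots F ∧ ∀ A : Set (Fin n → ℝ), IsArc A → A ⊆ roots F → z ∈ A → A = {z}

/-- The Jacobian matrix `(∂ fᵢ / ∂ xⱼ)` at `z`. -/
noncomputable def jacobian {n : ℕ} (F : Fin n → Fewnomial n) (z : Fin n → ℝ) :
    Matrix (Fin n) (Fin n) ℝ :=
  Matrix.of fun i j => fderiv ℝ (F i).eval z (Pi.single j 1)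

/-- A root is non-degenerate if the Jacobian matrix there has full rank. -/
def IsNondegenerateRoot {n : ℕ} (F : Fin n → Fewnomial n) (z : Fin n → ℝ) : Prop :=
  z ∈ roots F ∧ (jacobian F z).rank = n

/-- `𝒩(m₁, …, mₙ)`: the maximal number of isolated roots in the positive orthant of an `n × n`
fewnomial system of type `(m₁, …, mₙ)`. It is `⊤` if these numbers are not bounded; otherwise the
supremum is attained. -/
noncomputable def maxIsolated {n : ℕ} (m : Fin n → ℕ) : ℕ∞ :=
  ⨆ (F : Fin n → Fewnomial n) (_ : IsOfType F m), {z | IsIsolatedRoot F z}.encard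

/-- `𝒩'(m₁, …, mₙ)`: the maximal number of non-degenerate roots in the positive orthant of an
`n × n` fewnomial system of type `(m₁, …, mₙ)`, with the same convention. -/
noncomputable def maxNondegenerate {n : ℕ} (m : Fin n → ℕ) : ℕ∞ :=
  ⨆ (F : Fin n → Fewnomial n) (_ : IsOfType F m), {z | IsNondegenerateRoot F z}.encard

end Fewnomial

/-!
Let `F = (f, g)` with `f` a trinomial and `g` an `m`-nomial. Divide `f` by one of its monomials. If
the three coefficients have the same sign there is no root. If the exponents of `f` are collinear,
the zero set of `f` is a union of at most two lines in logarithmic coordinates, on which `g` is a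
sum of at most `m` exponentials; hence there are at most `2 (m - 1)` isolated roots, and that many
non-degenerate roots are attained by a system in separated variables
(`encard_isolated_le_of_collinear`, `two_mul_le_maxNondegenerate`). Otherwise a monomial change of
variables turns `f` into `1 - x - y`, and the roots of `F` into the zeros in `(0, 1)` of
`∑ cᵢ s ^ aᵢ (1 - s) ^ bᵢ` with `m` terms (`SegmentParametrization`).

* Upper bound. Dividing a sum `∑ pᵢ s ^ aᵢ (1 - s) ^ bᵢ` with polynomial coefficients of degree
  `≤ d` by one of its monomials and differentiating `d + 1` times removes one term and raises
  the degrees to at most `2 d + 1`. By Rolle's theorem and induction there are at most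
  `(d + 1) (2 ^ m - 1) - 1` zeros (`zeros_segmentSum`).
* Three terms. Normalize to `U + V = 1` with `U`, `V` positive multiples of monomials. It
  suffices to find at most four critical points of `U + V`, and these solve `U P + V Q = 0` with `P`
  and `Q` affine. Proportional exponents are an easy special case; apart from it, `P` and `Q` have no
  common zero. In the region `P Q < 0` they are the zeros of a function `log |U P / V Q|`
  whose derivative has a cubic numerator. If only one of the two sign patterns of `(P, Q)` contains
  critical points, the relevant region is an interval, and four is the bound given by Rolle's
  theorem. Otherwise the exponents of `U` are positive and those of `V` negative, or vice versa; then
  `log |U P / V Q|` is concave on one of the two intervals, and a convexity argument shows that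
  the other one contains at most one critical point (`encard_critical_le`, `encard_add_le_five`).
  Five roots occur for `fiveRootSystem`.
* Non-degenerate roots are isolated by the inverse function theorem. Conversely, let `h` be the
  quotient by one monomial of `g` on the curve. Near each of its zeros `h` takes one of the values
  `± ε` on either side, so the level sets of `ε` and `-ε` together have at least twice as many points
  as the zero set, and for all but finitely many `ε` these points are regular. Passing from `h` to `h ∓ ε` only
  changes one coefficient of `g` (`eventually_two_mul_encard_le`,
  `encard_level_le_maxNondegenerate`).
-/

namespace Fewnomial

open Set Filter Topology Polynomial

/-! ### Counting zeros by Rolle's theorem -/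

theorem encard_zeros_le_of_hasDerivAt {s : Set ℝ} (hs : s.OrdConnected) {f f' : ℝ → ℝ}
    (hf : ∀ x ∈ s, HasDerivAt f (f' x) x) :
    {x ∈ s | f x = 0}.encard ≤ {x ∈ s | f' x = 0}.encard + 1 := by
  by_cases hfin : {x ∈ s | f' x = 0}.Finite
  · have key : ∀ u : Finset ℝ, (u : Set ℝ) ⊆ {x ∈ s | f x = 0} →
        u.card ≤ hfin.toFinset.card + 1 := by
      intro u hu
      refine Finset.card_le_of_interleaved fun x hx y hy hxy _ => ?_
      have hsub : Icc x y ⊆ s := hs.out (hu hx).1 (hu hy).1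
      obtain ⟨c, hc, hc0⟩ := exists_hasDerivAt_eq_zero hxy
        (fun z hz => (hf z (hsub hz)).continuousAt.continuousWithinAt)
        ((hu hx).2.trans (hu hy).2.symm)
        (fun z hz => hf z (hsub (Ioo_subset_Icc_self hz)))
      exact ⟨c, by simpa using ⟨hsub (Ioo_subset_Icc_self hc), hc0⟩, hc.1, hc.2⟩
    by_contra! hlt
    rw [hfin.encard_eq_coe_toFinset_card] at hlt
    have : ((hfin.toFinset.card + 2 : ℕ) : ℕ∞) ≤ {x ∈ s | f x = 0}.encard := by
      have := Order.add_one_le_of_lt hlt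
      simpa [add_assoc, one_add_one_eq_two] using this
    obtain ⟨t, ht, htc⟩ := exists_subset_encard_eq this
    have htf : t.Finite := finite_of_encard_eq_coe htc
    have := key htf.toFinset (by simpa using ht)
    rw [htf.encard_eq_coe_toFinset_card] at htc
    have : htf.toFinset.card = hfin.toFinset.card + 2 := by exact_mod_cast htc
    omega
  · rw [Set.Infinite.encard_eq hfin]; simp

theorem eq_const_of_hasDerivAt_zero {s : Set ℝ} (hs : s.OrdConnected) {f f' : ℝ → ℝ}
    (hf : ∀ x ∈ s, HasDerivAt f (f' x) x) (h0 : ∀ x ∈ s, f' x = 0) {x y : ℝ} (hx : x ∈ s)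
    (hy : y ∈ s) : f x = f y :=
  hs.convex.is_const_of_fderivWithin_eq_zero (𝕜 := ℝ)
    (fun z hz => (hf z hz).differentiableAt.differentiableWithinAt)
    (fun z hz => by
      by_cases hu : UniqueDiffWithinAt ℝ s z
      · rw [(hf z hz).hasFDerivAt.hasFDerivWithinAt.fderivWithin hu, h0 z hz]; ext; simp
      · exact fderivWithin_zero_of_not_uniqueDiffWithinAt hu) hx hy

/-- A function on an interval vanishes identically, or has at most one zero more than its
derivative, provided the same alternative, with a bound `k`, holds for the derivative. -/
theorem zeros_alternative_of_hasDerivAt {s : Set ℝ} (hs : s.OrdConnected) {f f' : ℝ → ℝ}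
    (hf : ∀ x ∈ s, HasDerivAt f (f' x) x) {k : ℕ∞}
    (h : (∀ x ∈ s, f' x = 0) ∨ {x ∈ s | f' x = 0}.encard + 1 ≤ k) :
    (∀ x ∈ s, f x = 0) ∨ {x ∈ s | f x = 0}.encard + 1 ≤ k + 1 := by
  rcases h with h | h
  · by_cases h0 : ∃ x ∈ s, f x = 0
    · obtain ⟨x, hx, hx0⟩ := h0
      exact .inl fun y hy => (eq_const_of_hasDerivAt_zero hs hf h hy hx).trans hx0
    · right
      have : {x ∈ s | f x = 0} = ∅ := by
        ext x; simp only [mem_ofPred_eq, mem_empty_iff_false, iff_false]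
        exact fun hx => h0 ⟨x, hx⟩
      simp [this]
  · right
    gcongr
    exact (encard_zeros_le_of_hasDerivAt hs hf).trans h

/-- `∑ pᵢ(x) x ^ aᵢ (1 - x) ^ bᵢ`, the shape taken by a fewnomial on the segment
`{(x, 1 - x)}`, and by its derivatives. -/
noncomputable def segmentSum {ι : Type*} (S : Finset ι) (p : ι → ℝ[X]) (a b : ι → ℝ) (x : ℝ) : ℝ :=
  ∑ i ∈ S, (p i).eval x * (x ^ a i * (1 - x) ^ b i)

/-- The polynomial `q` with `(p x ^ a (1 - x) ^ b)' = q x ^ (a - 1) (1 - x) ^ (b - 1)`. -/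
noncomputable def segmentDeriv (p : ℝ[X]) (a b : ℝ) : ℝ[X] :=
  derivative p * (X * (1 - X)) + p * (C a * (1 - X) - C b * X)

theorem natDegree_segmentDeriv_le {p : ℝ[X]} {d : ℕ} (hp : p.natDegree ≤ d) (a b : ℝ) :
    (segmentDeriv p a b).natDegree ≤ d + 1 := by
  unfold segmentDeriv
  refine natDegree_add_le_of_degree_le ?_ ?_
  · rcases Nat.eq_zero_or_pos p.natDegree with h | h
    · rw [natDegree_eq_zero.1 h |>.choose_spec.symm]; simp
    · refine natDegree_mul_le.trans ?_
      have h1 := natDegree_derivative_le p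
      have h2 : (X * (1 - X) : ℝ[X]).natDegree ≤ 2 := by compute_degree
      omega
  · refine natDegree_mul_le.trans ?_
    have h2 : (C a * (1 - X) - C b * X : ℝ[X]).natDegree ≤ 1 := by compute_degree
    omega

theorem hasDerivAt_segmentTerm (p : ℝ[X]) (a b : ℝ) {x : ℝ} (hx : x ∈ Ioo (0 : ℝ) 1) :
    HasDerivAt (fun x => p.eval x * (x ^ a * (1 - x) ^ b))
      ((segmentDeriv p a b).eval x * (x ^ (a - 1) * (1 - x) ^ (b - 1))) x := by
  have h0 : x ≠ 0 := hx.1.ne'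
  have h1 : 1 - x ≠ 0 := (sub_pos.2 hx.2).ne'
  have := (p.hasDerivAt x).mul ((Real.hasDerivAt_rpow_const (p := a) (Or.inl h0)).mul
    (((hasDerivAt_id x).const_sub 1).rpow_const (p := b) (Or.inl h1)))
  refine this.congr_deriv ?_
  have e0 : x ^ a = x ^ (a - 1) * x := by
    rw [Real.rpow_sub_one h0]; field_simp
  have e1 : (1 - x) ^ b = (1 - x) ^ (b - 1) * (1 - x) := by
    rw [Real.rpow_sub_one h1]; field_simp
  simp only [segmentDeriv, eval_add, eval_mul, eval_sub, eval_X, eval_one, eval_C, id, Pi.mul_apply]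
  rw [e0, e1]; ring

theorem hasDerivAt_segmentSum {ι : Type*} (S : Finset ι) (p : ι → ℝ[X]) (a b : ι → ℝ) {x : ℝ}
    (hx : x ∈ Ioo (0 : ℝ) 1) :
    HasDerivAt (segmentSum S p a b) (segmentSum S (fun i => segmentDeriv (p i) (a i) (b i))
      (fun i => a i - 1) (fun i => b i - 1) x) x := by
  unfold segmentSum
  exact HasDerivAt.fun_sum fun i _ => hasDerivAt_segmentTerm (p i) (a i) (b i) hx

/-- Dividing by `x ^ r (1 - x) ^ s` does not affect the zeros. -/
theorem segmentSum_eq_mul {ι : Type*} (S : Finset ι) (p : ι → ℝ[X]) (a b : ι → ℝ) (r s : ℝ) {x : ℝ}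
    (hx : x ∈ Ioo (0 : ℝ) 1) :
    segmentSum S p a b x = (x ^ r * (1 - x) ^ s) *
      segmentSum S p (fun i => a i - r) (fun i => b i - s) x := by
  unfold segmentSum
  rw [Finset.mul_sum]
  refine Finset.sum_congr rfl fun i _ => ?_
  rw [Real.rpow_sub hx.1, Real.rpow_sub (sub_pos.2 hx.2)]
  have := (Real.rpow_pos_of_pos hx.1 r).ne'
  have := (Real.rpow_pos_of_pos (sub_pos.2 hx.2) s).ne'
  field_simp

/-- Adding a polynomial of degree `< n` costs `n` derivations, each of which raises the degrees
of the remaining coefficients by one. -/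
theorem zeros_polynomial_add_segmentSum {ι : Type*} (S : Finset ι) {N : ℕ}
    (hS : ∀ (d : ℕ) (p : ι → ℝ[X]) (a b : ι → ℝ), (∀ i ∈ S, (p i).natDegree ≤ d) →
      (∀ x ∈ Ioo (0 : ℝ) 1, segmentSum S p a b x = 0) ∨
      {x ∈ Ioo (0 : ℝ) 1 | segmentSum S p a b x = 0}.encard + 1 ≤ ((d + 1) * N : ℕ))
    (n d : ℕ) (q : ℝ[X]) (hq : q.degree < n) (p : ι → ℝ[X]) (a b : ι → ℝ)
    (hp : ∀ i ∈ S, (p i).natDegree ≤ d) :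
    (∀ x ∈ Ioo (0 : ℝ) 1, q.eval x + segmentSum S p a b x = 0) ∨
      {x ∈ Ioo (0 : ℝ) 1 | q.eval x + segmentSum S p a b x = 0}.encard + 1 ≤
        (n + (d + n + 1) * N : ℕ) := by
  induction n generalizing d q p a b with
  | zero =>
    have : q = 0 := by simpa [Polynomial.degree_lt_iff_coeff_zero, Polynomial.ext_iff] using hq
    simpa [this] using hS d p a b hp
  | succ n ih =>
    have hq' : (derivative q).degree < n := by
      rcases eq_or_ne q 0 with rfl | h0
      · simp
      · rw [degree_lt_iff_coeff_zero] at hq ⊢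
        intro k hk
        rw [coeff_derivative, hq (k + 1) (by omega), zero_mul]
    have := zeros_alternative_of_hasDerivAt ordConnected_Ioo
      (fun x hx => (q.hasDerivAt x).add (hasDerivAt_segmentSum S p a b hx))
      (ih (d + 1) (derivative q) hq' _ _ _ fun i hi => natDegree_segmentDeriv_le (hp i hi) _ _)
    refine this.imp id fun h => h.trans_eq ?_
    push_cast
    ring

/-- `m` terms with coefficients of degree `≤ d` have at most `(d + 1) (2 ^ m - 1) - 1` zeros
in `(0, 1)` unless their sum vanishes identically there. -/
theorem zeros_segmentSum {ι : Type*} (S : Finset ι) (d : ℕ) (p : ι → ℝ[X]) (a b : ι → ℝ)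
    (hp : ∀ i ∈ S, (p i).natDegree ≤ d) :
    (∀ x ∈ Ioo (0 : ℝ) 1, segmentSum S p a b x = 0) ∨
      {x ∈ Ioo (0 : ℝ) 1 | segmentSum S p a b x = 0}.encard + 1 ≤
        ((d + 1) * (2 ^ S.card - 1) : ℕ) := by
  classical
  induction S using Finset.induction_on generalizing d p a b with
  | empty => left; simp [segmentSum]
  | insert i S hi ih =>
    have hq : (p i).degree < (d + 1 : ℕ) :=
      (degree_le_of_natDegree_le (hp i (by simp))).trans_lt (by exact_mod_cast Nat.lt_succ_self d)
    have := zeros_polynomial_add_segmentSum S ih (d + 1) d (p i) hq p (fun j => a j - a i)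
      (fun j => b j - b i) fun j hj => hp j (by simp [hj])
    have hz : ∀ x ∈ Ioo (0 : ℝ) 1, segmentSum (insert i S) p a b x = 0 ↔
        (p i).eval x + segmentSum S p (fun j => a j - a i) (fun j => b j - b i) x = 0 := by
      intro x hx
      have h1 := (Real.rpow_pos_of_pos hx.1 (a i)).ne'
      have h2 := (Real.rpow_pos_of_pos (sub_pos.2 hx.2) (b i)).ne'
      rw [segmentSum_eq_mul _ p a b (a i) (b i) hx, mul_eq_zero, or_iff_right (mul_ne_zero h1 h2)]
      simp [segmentSum, Finset.sum_insert hi]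
    have hset : {x ∈ Ioo (0 : ℝ) 1 | segmentSum (insert i S) p a b x = 0} =
        {x ∈ Ioo (0 : ℝ) 1 | (p i).eval x +
          segmentSum S p (fun j => a j - a i) (fun j => b j - b i) x = 0} := by
      ext x; exact and_congr_right (hz x)
    rw [hset]
    refine this.imp (fun h x hx => (hz x hx).2 (h x hx)) fun h => h.trans_eq ?_
    rw [Finset.card_insert_of_notMem hi]
    congr 1
    obtain ⟨k, hk⟩ : ∃ k, 2 ^ S.card = k + 1 := ⟨2 ^ S.card - 1, by
      have := Nat.one_le_two_pow (n := S.card); omega⟩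
    rw [pow_succ, hk, show (k + 1) * 2 - 1 = 2 * k + 1 by omega, Nat.add_sub_cancel]; ring

/-- A sum of `m` real exponentials has at most `m - 1` zeros or vanishes identically. -/
theorem zeros_expSum {ι : Type*} (S : Finset ι) (c k : ι → ℝ) :
    (∀ t : ℝ, ∑ i ∈ S, c i * Real.exp (k i * t) = 0) ∨
      {t : ℝ | ∑ i ∈ S, c i * Real.exp (k i * t) = 0}.encard + 1 ≤ (S.card : ℕ∞) := by
  classical
  induction S using Finset.induction_on generalizing c k with
  | empty => left; simp
  | insert i S hi ih =>
    have hd : ∀ t ∈ univ, HasDerivAt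
        (fun t => c i + ∑ j ∈ S, c j * Real.exp ((k j - k i) * t))
        (∑ j ∈ S, (c j * (k j - k i)) * Real.exp ((k j - k i) * t)) t := by
      intro t _
      refine (HasDerivAt.fun_sum fun j _ => ?_).const_add _
      have := (((hasDerivAt_id t).const_mul (k j - k i)).exp).const_mul (c j)
      refine this.congr_deriv ?_
      simp only [id]
      ring
    have := zeros_alternative_of_hasDerivAt ordConnected_univ hd
      (by simpa using ih (fun j => c j * (k j - k i)) (fun j => k j - k i))
    have hz : ∀ t : ℝ, ∑ j ∈ insert i S, c j * Real.exp (k j * t) = 0 ↔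
        c i + ∑ j ∈ S, c j * Real.exp ((k j - k i) * t) = 0 := by
      intro t
      have : ∑ j ∈ insert i S, c j * Real.exp (k j * t) = Real.exp (k i * t) *
          (c i + ∑ j ∈ S, c j * Real.exp ((k j - k i) * t)) := by
        rw [Finset.sum_insert hi, mul_add, Finset.mul_sum, mul_comm]
        congr 1
        refine Finset.sum_congr rfl fun j _ => ?_
        rw [mul_left_comm, ← Real.exp_add]; ring_nf
      rw [this, mul_eq_zero, or_iff_right (Real.exp_ne_zero _)]
    simp only [hz, Finset.card_insert_of_notMem hi]
    simpa using this

/-! ### Two monomials and a constant on a segment -/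

/-- The monomial `A x ^ a (1 - x) ^ b`. -/
noncomputable def segmentMonomial (A a b x : ℝ) : ℝ := A * (x ^ a * (1 - x) ^ b)

/-- `x (1 - x)` times the logarithmic derivative of `x ^ a (1 - x) ^ b`. -/
def segmentSlope (a b x : ℝ) : ℝ := a * (1 - x) - b * x

theorem segmentMonomial_pos {A a b x : ℝ} (hA : 0 < A) (hx : x ∈ Ioo (0 : ℝ) 1) :
    0 < segmentMonomial A a b x :=
  mul_pos hA (mul_pos (Real.rpow_pos_of_pos hx.1 _) (Real.rpow_pos_of_pos (sub_pos.2 hx.2) _))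

theorem log_segmentMonomial {A a b x : ℝ} (hA : 0 < A) (hx : x ∈ Ioo (0 : ℝ) 1) :
    Real.log (segmentMonomial A a b x) = Real.log A + (a * Real.log x + b * Real.log (1 - x)) := by
  have h1 := Real.rpow_pos_of_pos hx.1 a
  have h2 := Real.rpow_pos_of_pos (sub_pos.2 hx.2) b
  rw [segmentMonomial, Real.log_mul hA.ne' (mul_pos h1 h2).ne', Real.log_mul h1.ne' h2.ne',
    Real.log_rpow hx.1, Real.log_rpow (sub_pos.2 hx.2)]

theorem hasDerivAt_segmentMonomial (A a b : ℝ) {x : ℝ} (hx : x ∈ Ioo (0 : ℝ) 1) :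
    HasDerivAt (segmentMonomial A a b)
      (segmentMonomial A a b x * segmentSlope a b x / (x * (1 - x))) x := by
  have h := hasDerivAt_segmentTerm (C A) a b hx
  simp only [eval_C] at h
  refine h.congr_deriv ?_
  have h0 : x ≠ 0 := hx.1.ne'
  have h1 : 1 - x ≠ 0 := (sub_pos.2 hx.2).ne'
  simp only [segmentDeriv, segmentMonomial, segmentSlope, derivative_C, zero_mul, zero_add,
    eval_mul, eval_C, eval_sub, eval_one, eval_X]
  rw [Real.rpow_sub_one h0, Real.rpow_sub_one h1]
  field_simp

theorem hasDerivAt_segmentSlope (a b x : ℝ) : HasDerivAt (segmentSlope a b) (-(a + b)) x := by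
  have := (((hasDerivAt_id x).const_sub 1).const_mul a).sub ((hasDerivAt_id x).const_mul b)
  refine this.congr_deriv ?_
  ring

/-- The critical points in `(0, 1)` of `A x ^ a (1 - x) ^ b + B x ^ c (1 - x) ^ d`. -/
def segmentCritical (A a b B c d : ℝ) : Set ℝ :=
  {x ∈ Ioo (0 : ℝ) 1 | segmentMonomial A a b x * segmentSlope a b x +
    segmentMonomial B c d x * segmentSlope c d x = 0}

theorem segmentCritical_swap (A a b B c d : ℝ) :
    segmentCritical A a b B c d = segmentCritical B c d A a b := by
  ext x; simp only [segmentCritical, mem_ofPred_eq, add_comm]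

theorem segmentCritical_reflect (A a b B c d : ℝ) :
    segmentCritical A a b B c d = (fun x => 1 - x) '' segmentCritical A b a B d c := by
  have key : ∀ A a b B c d x, x ∈ segmentCritical A a b B c d →
      1 - x ∈ segmentCritical A b a B d c := by
    rintro A a b B c d x ⟨⟨h0, h1⟩, h⟩
    refine ⟨⟨by linarith, by linarith⟩, ?_⟩
    simp only [segmentMonomial, segmentSlope, sub_sub_cancel] at h ⊢
    linarith
  ext x
  refine ⟨fun h => ⟨1 - x, key _ _ _ _ _ _ _ h, by simp⟩, ?_⟩
  rintro ⟨y, hy, rfl⟩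
  exact key _ _ _ _ _ _ _ hy

/-- `log |U P / V Q|` where `U`, `V` are two monomials on the segment and `P`, `Q` the numerators of
their logarithmic derivatives; `Real.log` takes absolute values by convention. Where `P Q < 0`,
its zeros are the critical points of `U + V`. -/
noncomputable def logRatio (A a b B c d x : ℝ) : ℝ :=
  (a - c) * Real.log x + (b - d) * Real.log (1 - x) + Real.log (segmentSlope a b x)
    - Real.log (segmentSlope c d x) + (Real.log A - Real.log B)

/-- The derivative of `logRatio` where both slopes are non-zero. -/
noncomputable def logRatioDeriv (a b c d x : ℝ) : ℝ :=
  (a - c) / x - (b - d) / (1 - x) - (a + b) / segmentSlope a b x + (c + d) / segmentSlope c d x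

theorem hasDerivAt_log_segment (p q : ℝ) {x : ℝ} (hx : x ∈ Ioo (0 : ℝ) 1) :
    HasDerivAt (fun x => p * Real.log x + q * Real.log (1 - x)) (p / x - q / (1 - x)) x := by
  have h1 : 1 - x ≠ 0 := (sub_pos.2 hx.2).ne'
  have := ((Real.hasDerivAt_log hx.1.ne').const_mul p).add
    ((((hasDerivAt_id x).const_sub 1).log h1).const_mul q)
  refine this.congr_deriv ?_
  simp only [id]; ring

theorem hasDerivAt_logRatio (A a b B c d : ℝ) {x : ℝ} (hx : x ∈ Ioo (0 : ℝ) 1)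
    (hP : segmentSlope a b x ≠ 0) (hQ : segmentSlope c d x ≠ 0) :
    HasDerivAt (logRatio A a b B c d) (logRatioDeriv a b c d x) x := by
  have := (((hasDerivAt_log_segment (a - c) (b - d) hx).add
    ((hasDerivAt_segmentSlope a b x).log hP)).sub
    ((hasDerivAt_segmentSlope c d x).log hQ)).add_const (Real.log A - Real.log B)
  refine this.congr_deriv ?_
  unfold logRatioDeriv; ring

theorem logRatio_eq_zero_iff {A a b B c d x : ℝ} (hA : 0 < A) (hB : 0 < B)
    (hx : x ∈ Ioo (0 : ℝ) 1) (h : segmentSlope a b x * segmentSlope c d x < 0) :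
    logRatio A a b B c d x = 0 ↔ x ∈ segmentCritical A a b B c d := by
  have hU := segmentMonomial_pos (a := a) (b := b) hA hx
  have hV := segmentMonomial_pos (a := c) (b := d) hB hx
  have hP : segmentSlope a b x ≠ 0 := fun h0 => by simp [h0] at h
  have hQ : segmentSlope c d x ≠ 0 := fun h0 => by simp [h0] at h
  have e : logRatio A a b B c d x = Real.log |segmentMonomial A a b x * segmentSlope a b x| -
      Real.log |segmentMonomial B c d x * segmentSlope c d x| := by
    rw [Real.log_abs, Real.log_abs, Real.log_mul hU.ne' hP, Real.log_mul hV.ne' hQ,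
      log_segmentMonomial hA hx, log_segmentMonomial hB hx, logRatio]
    ring
  rw [e, sub_eq_zero, Real.log_injOn_pos.eq_iff (abs_pos.2 (mul_ne_zero hU.ne' hP))
    (abs_pos.2 (mul_ne_zero hV.ne' hQ)), abs_eq_abs, segmentCritical, mem_ofPred_eq,
    and_iff_right hx, add_eq_zero_iff_eq_neg, or_iff_right]
  intro h0
  have : 0 ≤ segmentMonomial A a b x * segmentSlope a b x *
    (segmentMonomial B c d x * segmentSlope c d x) := by rw [h0]; exact mul_self_nonneg _
  have h2 := mul_pos hU hV
  nlinarith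

theorem encard_zeros_polynomial_le {R : ℝ[X]} (hR : R ≠ 0) {n : ℕ} (hn : R.natDegree ≤ n) :
    {x | R.eval x = 0}.encard ≤ n := by
  have : {x | R.eval x = 0} = (R.roots.toFinset : Set ℝ) := by
    ext x; simp [hR]
  rw [this, encard_coe_eq_coe_finsetCard]
  exact_mod_cast (Multiset.toFinset_card_le _).trans ((card_roots' R).trans hn)

/-- The derivative of `logRatio` is a cubic polynomial over a common denominator. -/
theorem encard_logRatioDeriv_le (a b c d : ℝ) {s : Set ℝ}
    (hs : ∀ x ∈ s, x ∈ Ioo (0 : ℝ) 1 ∧ segmentSlope a b x ≠ 0 ∧ segmentSlope c d x ≠ 0) :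
    (∀ x ∈ s, logRatioDeriv a b c d x = 0) ∨
      {x ∈ s | logRatioDeriv a b c d x = 0}.encard + 1 ≤ 4 := by
  let P : ℝ[X] := C a * (1 - X) - C b * X
  let Q : ℝ[X] := C c * (1 - X) - C d * X
  let R : ℝ[X] := C (a - c) * (1 - X) * P * Q - C (b - d) * X * P * Q
    - C (a + b) * X * (1 - X) * Q + C (c + d) * X * (1 - X) * P
  have hR : ∀ x ∈ s, logRatioDeriv a b c d x = 0 ↔ R.eval x = 0 := by
    intro x hx
    obtain ⟨⟨h0, h1⟩, hP, hQ⟩ := hs x hx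
    have h1' : 1 - x ≠ 0 := (sub_pos.2 h1).ne'
    have e : R.eval x = logRatioDeriv a b c d x *
        (x * (1 - x) * segmentSlope a b x * segmentSlope c d x) := by
      have hPe : P.eval x = segmentSlope a b x := by simp [P, segmentSlope]
      have hQe : Q.eval x = segmentSlope c d x := by simp [Q, segmentSlope]
      simp only [R, eval_add, eval_sub, eval_mul, eval_C, eval_X, eval_one, hPe, hQe,
        logRatioDeriv]
      field_simp
    rw [e, mul_eq_zero, or_iff_left]
    exact mul_ne_zero (mul_ne_zero (mul_ne_zero h0.ne' h1') hP) hQ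
  rcases eq_or_ne R 0 with h0 | h0
  · left; intro x hx; rw [hR x hx, h0]; simp
  · right
    have hd : R.natDegree ≤ 3 := by simp only [R, P, Q]; compute_degree
    have : {x ∈ s | logRatioDeriv a b c d x = 0}.encard ≤ 3 :=
      (encard_le_encard fun x hx => (hR x hx.1).1 hx.2).trans (encard_zeros_polynomial_le h0 hd)
    calc _ ≤ (3 : ℕ∞) + 1 := by gcongr
      _ = 4 := by norm_num

theorem convex_segmentSlope_pos (a b : ℝ) : Convex ℝ {x | 0 < segmentSlope a b x} := by
  have : {x | 0 < segmentSlope a b x} = {x | -a < (-(a + b)) * x} := by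
    ext x; simp only [segmentSlope, mem_ofPred_eq]; constructor <;> intro h <;> linarith
  rw [this]
  exact convex_halfSpace_gt (IsLinearMap.isLinearMap_smul (-(a + b))) _

theorem convex_segmentSlope_neg (a b : ℝ) : Convex ℝ {x | segmentSlope a b x < 0} := by
  convert convex_segmentSlope_pos (-a) (-b) using 3 with x
  simp only [segmentSlope]; constructor <;> intro h <;> linarith

theorem continuous_segmentSlope (a b : ℝ) : Continuous (segmentSlope a b) := by
  unfold segmentSlope; fun_prop

/-- On the interval where the first slope is positive and the second negative there are at most
four critical points. -/
theorem encard_critical_posneg_le {A a b B c d : ℝ} (hA : 0 < A) (hB : 0 < B)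
    (hfin : (segmentCritical A a b B c d).Finite) :
    {x ∈ segmentCritical A a b B c d | 0 < segmentSlope a b x ∧ segmentSlope c d x < 0}.encard
      ≤ 4 := by
  set s : Set ℝ := Ioo 0 1 ∩ ({x | 0 < segmentSlope a b x} ∩ {x | segmentSlope c d x < 0}) with hs
  have hso : IsOpen s := isOpen_Ioo.inter
    ((isOpen_lt continuous_const (continuous_segmentSlope a b)).inter
      (isOpen_lt (continuous_segmentSlope c d) continuous_const))
  have hsc : s.OrdConnected := ((convex_Ioo 0 1).inter
    ((convex_segmentSlope_pos a b).inter (convex_segmentSlope_neg c d))).ordConnected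
  have hz : ∀ x ∈ s, logRatio A a b B c d x = 0 ↔ x ∈ segmentCritical A a b B c d :=
    fun x hx => logRatio_eq_zero_iff hA hB hx.1 (mul_neg_of_pos_of_neg hx.2.1 hx.2.2)
  have heq : {x ∈ segmentCritical A a b B c d | 0 < segmentSlope a b x ∧ segmentSlope c d x < 0} =
      {x ∈ s | logRatio A a b B c d x = 0} := by
    ext x
    constructor
    · intro h
      have hx : x ∈ s := ⟨h.1.1, h.2⟩
      exact ⟨hx, (hz x hx).2 h.1⟩
    · intro h
      exact ⟨(hz x h.1).1 h.2, h.1.2⟩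
  rw [heq]
  rcases zeros_alternative_of_hasDerivAt hsc
    (fun x hx => hasDerivAt_logRatio A a b B c d hx.1 (ne_of_gt hx.2.1) (ne_of_lt hx.2.2))
    (encard_logRatioDeriv_le a b c d
      fun x hx => ⟨hx.1, ne_of_gt hx.2.1, ne_of_lt hx.2.2⟩) with h | h
  · have hsub : s ⊆ segmentCritical A a b B c d := fun x hx => (hz x hx).1 (h x hx)
    have : s = ∅ := by
      by_contra hne
      obtain ⟨x, hx⟩ := nonempty_iff_ne_empty.2 hne
      exact (infinite_of_mem_nhds x (hso.mem_nhds hx)) (hfin.subset hsub)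
    simp [this]
  · have : {x ∈ s | logRatio A a b B c d x = 0}.encard + 1 ≤ 4 + 1 := h
    exact (ENat.add_le_add_iff_right (by simp)).1 this

theorem segmentSlope_zero_unique {a b : ℝ} (h : ¬(a = 0 ∧ b = 0)) {x y : ℝ}
    (hx : segmentSlope a b x = 0) (hy : segmentSlope a b y = 0) : x = y := by
  simp only [segmentSlope] at hx hy
  by_contra hne
  have h1 : (a + b) * (x - y) = 0 := by linarith
  have h2 : a + b = 0 := (mul_eq_zero.1 h1).resolve_right (sub_ne_zero.2 hne)
  have : a = 0 := by linear_combination hx + x * h2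
  exact h ⟨this, by linarith⟩

theorem encard_segmentSlope_zeros_le {a b : ℝ} (h : ¬(a = 0 ∧ b = 0)) (s : Set ℝ) :
    {x ∈ s | segmentSlope a b x = 0}.encard ≤ 1 :=
  encard_le_one_iff.2 fun _ _ hx hy => segmentSlope_zero_unique h hx.2 hy.2

/-- If the two exponent vectors are proportional, `U P + V Q` is a multiple of `P`, and `log |U / V|`
has at most one critical point. -/
theorem encard_critical_le_of_proportional {A a b B c d : ℝ} (hA : 0 < A) (hB : 0 < B)
    (hab : ¬(a = 0 ∧ b = 0)) (hcd : ¬(c = 0 ∧ d = 0)) (hdet : a * d = b * c) :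
    (segmentCritical A a b B c d).encard ≤ 4 := by
  obtain ⟨k, hk0, rfl, rfl⟩ : ∃ k : ℝ, k ≠ 0 ∧ c = k * a ∧ d = k * b := by
    by_cases ha : a = 0
    · have hb : b ≠ 0 := fun hb => hab ⟨ha, hb⟩
      have hc : c = 0 := by
        have : b * c = 0 := by rw [← hdet, ha, zero_mul]
        exact (mul_eq_zero.1 this).resolve_left hb
      have hd : d ≠ 0 := fun hd => hcd ⟨hc, hd⟩
      exact ⟨d / b, div_ne_zero hd hb, by rw [hc, ha, mul_zero], by field_simp⟩
    · have hc : c ≠ 0 := by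
        intro hc
        have : a * d = 0 := by rw [hdet, hc, mul_zero]
        exact hcd ⟨hc, (mul_eq_zero.1 this).resolve_left ha⟩
      refine ⟨c / a, div_ne_zero hc ha, by field_simp, ?_⟩
      field_simp
      linarith
  have hslope : ∀ x, segmentSlope (k * a) (k * b) x = k * segmentSlope a b x := by
    intro x; simp only [segmentSlope]; ring
  let ψ : ℝ → ℝ := fun x => ((1 - k) * a * Real.log x + (1 - k) * b * Real.log (1 - x)) +
    (Real.log A - Real.log (-k * B))
  have hψ : ∀ x ∈ Ioo (0 : ℝ) 1, HasDerivAt ψ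
      ((1 - k) * a / x - (1 - k) * b / (1 - x)) x := fun x hx =>
    (hasDerivAt_log_segment _ _ hx).add_const _
  have hsub : segmentCritical A a b B (k * a) (k * b) ⊆
      {x ∈ Ioo (0 : ℝ) 1 | segmentSlope a b x = 0} ∪ {x ∈ Ioo (0 : ℝ) 1 | k < 0 ∧ ψ x = 0} := by
    rintro x ⟨hx, h⟩
    have hU := segmentMonomial_pos (a := a) (b := b) hA hx
    have hV := segmentMonomial_pos (a := k * a) (b := k * b) hB hx
    rw [hslope] at h
    have h' : segmentSlope a b x * (segmentMonomial A a b x +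
      k * segmentMonomial B (k * a) (k * b) x) = 0 := by linarith
    rcases mul_eq_zero.1 h' with h0 | h0
    · exact .inl ⟨hx, h0⟩
    · have hk : k < 0 := by
        by_contra hk
        have := mul_nonneg (not_lt.1 hk) hV.le
        linarith
      refine .inr ⟨hx, hk, ?_⟩
      have hkB : 0 < -k * B := mul_pos (neg_pos.2 hk) hB
      have e : segmentMonomial A a b x = segmentMonomial (-k * B) (k * a) (k * b) x := by
        simp only [segmentMonomial] at h0 ⊢; linarith
      have := congrArg Real.log e
      rw [log_segmentMonomial hA hx, log_segmentMonomial hkB hx] at this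
      simp only [ψ]; linarith
  have hψ2 : {x ∈ Ioo (0 : ℝ) 1 | k < 0 ∧ ψ x = 0}.encard ≤ 2 := by
    by_cases hk : k < 0
    · have h1 := encard_zeros_le_of_hasDerivAt ordConnected_Ioo hψ
      have h2 : {x ∈ Ioo (0 : ℝ) 1 | (1 - k) * a / x - (1 - k) * b / (1 - x) = 0}.encard ≤ 1 := by
        refine (encard_le_encard ?_).trans (encard_segmentSlope_zeros_le hab (Ioo 0 1))
        rintro x ⟨hx, h⟩
        refine ⟨hx, ?_⟩
        have h0 : x ≠ 0 := hx.1.ne'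
        have h1 : 1 - x ≠ 0 := (sub_pos.2 hx.2).ne'
        have hk1 : 1 - k ≠ 0 := by linarith
        field_simp at h
        have : (1 - k) * segmentSlope a b x = 0 := by
          simp only [segmentSlope]; linear_combination h
        exact (mul_eq_zero.1 this).resolve_left hk1
      calc _ = {x ∈ Ioo (0 : ℝ) 1 | ψ x = 0}.encard := by simp [hk]
        _ ≤ _ := h1
        _ ≤ 1 + 1 := by gcongr
        _ = 2 := by norm_num
    · simp [hk]
  calc _ ≤ _ := (encard_le_encard hsub).trans (encard_union_le _ _)
    _ ≤ 1 + 2 := by gcongr; exact encard_segmentSlope_zeros_le hab _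
    _ ≤ 4 := by norm_num

/-- If `a, b > 0 > c, d` and the zero of `P` lies to the left of the zero of `Q`, the logarithmic
ratio is strictly concave on the interval where `P > 0 > Q`. -/
theorem encard_critical_concave_le {A a b B c d : ℝ} (hA : 0 < A) (hB : 0 < B)
    (ha : 0 < a) (hb : 0 < b) (hc : c < 0) (hd : d < 0) (hdet : b * c < a * d) :
    {x ∈ segmentCritical A a b B c d | 0 < segmentSlope a b x ∧ segmentSlope c d x < 0}.encard
      ≤ 2 := by
  set s : Set ℝ := Ioo 0 1 ∩ ({x | 0 < segmentSlope a b x} ∩ {x | segmentSlope c d x < 0}) with hs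
  have hsc : s.OrdConnected := ((convex_Ioo 0 1).inter
    ((convex_segmentSlope_pos a b).inter (convex_segmentSlope_neg c d))).ordConnected
  have hsub : {x ∈ segmentCritical A a b B c d | 0 < segmentSlope a b x ∧ segmentSlope c d x < 0} ⊆
      {x ∈ s | logRatio A a b B c d x = 0} := fun x h =>
    ⟨⟨h.1.1, h.2⟩, (logRatio_eq_zero_iff hA hB h.1.1 (mul_neg_of_pos_of_neg h.2.1 h.2.2)).2 h.1⟩
  have h1 := encard_zeros_le_of_hasDerivAt hsc
    (fun x hx => hasDerivAt_logRatio A a b B c d hx.1 (ne_of_gt hx.2.1) (ne_of_lt hx.2.2))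
  have h2 : ∀ x ∈ s, HasDerivAt (logRatioDeriv a b c d)
      (-(a - c) / x ^ 2 - (b - d) / (1 - x) ^ 2 - (a + b) ^ 2 / segmentSlope a b x ^ 2
        + (c + d) ^ 2 / segmentSlope c d x ^ 2) x := by
    intro x hx
    have h1x : 1 - x ≠ 0 := (sub_pos.2 hx.1.2).ne'
    have := ((((hasDerivAt_const x (a - c)).div (hasDerivAt_id x) hx.1.1.ne').sub
      ((hasDerivAt_const x (b - d)).div ((hasDerivAt_id x).const_sub 1) h1x)).sub
      ((hasDerivAt_const x (a + b)).div (hasDerivAt_segmentSlope a b x) (ne_of_gt hx.2.1))).add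
      ((hasDerivAt_const x (c + d)).div (hasDerivAt_segmentSlope c d x) (ne_of_lt hx.2.2))
    refine this.congr_deriv ?_
    simp only [id]; ring
  have h3 := encard_zeros_le_of_hasDerivAt hsc h2
  have h4 : {x ∈ s | -(a - c) / x ^ 2 - (b - d) / (1 - x) ^ 2 - (a + b) ^ 2 / segmentSlope a b x ^ 2
        + (c + d) ^ 2 / segmentSlope c d x ^ 2 = 0} = ∅ := by
    refine eq_empty_of_forall_notMem ?_
    rintro x ⟨⟨⟨h0, h1⟩, hP, hQ⟩, he⟩
    have t1 : 0 < (a - c) / x ^ 2 := div_pos (by linarith) (by positivity)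
    have t2 : 0 < (b - d) / (1 - x) ^ 2 := div_pos (by linarith) (pow_pos (sub_pos.2 h1) 2)
    have t3 : (c + d) ^ 2 / segmentSlope c d x ^ 2 ≤ (a + b) ^ 2 / segmentSlope a b x ^ 2 := by
      rw [← div_pow, ← div_pow]
      simp only [mem_ofPred_eq] at hP hQ
      have e : (c + d) / segmentSlope c d x = -(c + d) / -segmentSlope c d x := by
        rw [neg_div_neg_eq]
      rw [e]
      refine pow_le_pow_left₀ (div_nonneg (by linarith) (by linarith)) ?_ 2
      rw [div_le_div_iff₀ (by linarith) hP]
      simp only [segmentSlope]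
      nlinarith
    have : -(a - c) / x ^ 2 = -((a - c) / x ^ 2) := neg_div _ _
    linarith
  rw [h4] at h3
  calc _ ≤ _ := encard_le_encard hsub
    _ ≤ _ := h1
    _ ≤ (0 + 1) + 1 := by gcongr; simpa using h3
    _ = 2 := by norm_num

/-- At a critical point `z` where the level curve of `U + V` and the line touch with
opposite normals in logarithmic coordinates, `U + V` has a strict global minimum: both the line
and the level curve bound convex sets in these coordinates. -/
theorem segmentMonomial_add_lt {A a b B c d z x : ℝ} (hA : 0 < A) (hB : 0 < B)
    (hdet : b * c < a * d) (hz : z ∈ segmentCritical A a b B c d)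
    (hQ : 0 < segmentSlope c d z) (hx : x ∈ Ioo (0 : ℝ) 1) (hxz : x ≠ z) :
    segmentMonomial A a b z + segmentMonomial B c d z <
      segmentMonomial A a b x + segmentMonomial B c d x := by
  obtain ⟨hz01, hcrit⟩ := hz
  have hz1 : 0 < 1 - z := sub_pos.2 hz01.2
  have hx1 : 0 < 1 - x := sub_pos.2 hx.2
  have hU := segmentMonomial_pos (a := a) (b := b) hA hz01
  have hV := segmentMonomial_pos (a := c) (b := d) hB hz01
  set u := segmentMonomial A a b z
  set v := segmentMonomial B c d z
  set X := Real.log x - Real.log z with hX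
  set Y := Real.log (1 - x) - Real.log (1 - z) with hY
  have tangent : ∀ {D e f : ℝ}, 0 < D → segmentMonomial D e f z * (1 + (e * X + f * Y)) ≤
      segmentMonomial D e f x := by
    intro D e f hD
    have e1 : segmentMonomial D e f x = segmentMonomial D e f z * Real.exp (e * X + f * Y) := by
      rw [← Real.exp_log (segmentMonomial_pos (a := e) (b := f) hD hx),
        ← Real.exp_log (segmentMonomial_pos (a := e) (b := f) hD hz01), ← Real.exp_add,
        log_segmentMonomial hD hx, log_segmentMonomial hD hz01]
      congr 1; rw [hX, hY]; ring
    rw [e1]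
    have := Real.add_one_le_exp (e * X + f * Y)
    exact mul_le_mul_of_nonneg_left (by linarith) (segmentMonomial_pos hD hz01).le
  have hX' : z * X < x - z := by
    have h := Real.log_lt_sub_one_of_pos (div_pos hx.1 hz01.1)
      (by rw [Ne, div_eq_one_iff_eq hz01.1.ne']; exact hxz)
    rw [Real.log_div hx.1.ne' hz01.1.ne'] at h
    have := mul_lt_mul_of_pos_left h hz01.1
    have e : z * (x / z - 1) = x - z := by have := hz01.1.ne'; field_simp
    rwa [e] at this
  have hY' : (1 - z) * Y ≤ z - x := by
    have h := Real.log_le_sub_one_of_pos (div_pos hx1 hz1)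
    rw [Real.log_div hx1.ne' hz1.ne'] at h
    have := mul_le_mul_of_nonneg_left h hz1.le
    have e : (1 - z) * ((1 - x) / (1 - z) - 1) = z - x := by have := hz1.ne'; field_simp; ring
    rwa [e] at this
  -- `σ` is the ratio of the two normals; its sign is that of the determinant.
  set σ := u * (a + b) + v * (c + d) with hσ
  have hσ0 : σ < 0 := by
    have : σ * segmentSlope c d z = u * (b * c - a * d) := by
      simp only [segmentSlope] at hcrit ⊢
      rw [hσ]
      linear_combination (c + d) * hcrit
    by_contra hn
    have h1 := mul_nonneg (not_lt.1 hn) hQ.le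
    have h2 := mul_pos hU (sub_pos.2 hdet)
    linarith
  have hm : u * a + v * c = σ * z := by
    simp only [segmentSlope] at hcrit
    rw [hσ]; linear_combination hcrit
  have hn : u * b + v * d = σ * (1 - z) := by
    simp only [segmentSlope] at hcrit
    rw [hσ]; linear_combination -hcrit
  have t1 := tangent (e := a) (f := b) hA
  have t2 := tangent (e := c) (f := d) hB
  have t3 : 0 < σ * (z * X + (1 - z) * Y) := mul_pos_of_neg_of_neg hσ0 (by linarith)
  have t4 : u * (1 + (a * X + b * Y)) + v * (1 + (c * X + d * Y)) =
      u + v + σ * (z * X + (1 - z) * Y) := by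
    linear_combination X * hm + Y * hn
  linarith

theorem encard_critical_le_of_opposite_of_lt {A a b B c d : ℝ} (hA : 0 < A) (hB : 0 < B)
    (ha : 0 < a) (hb : 0 < b) (hc : c < 0) (hd : d < 0) (hdet : b * c < a * d) :
    (segmentCritical A a b B c d).encard ≤ 4 := by
  have hsub : segmentCritical A a b B c d ⊆
      {x ∈ segmentCritical A a b B c d | 0 < segmentSlope a b x ∧ segmentSlope c d x < 0} ∪
      {x ∈ segmentCritical A a b B c d | 0 < segmentSlope c d x} := by
    intro x hx
    have hU := segmentMonomial_pos (a := a) (b := b) hA hx.1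
    have hV := segmentMonomial_pos (a := c) (b := d) hB hx.1
    by_cases hQ : 0 < segmentSlope c d x
    · exact .inr ⟨hx, hQ⟩
    · have hx2 := hx.2
      rcases (not_lt.1 hQ).lt_or_eq with hQ | hQ
      · refine .inl ⟨hx, ?_, hQ⟩
        by_contra hP
        have h1 := mul_nonneg hU.le (neg_nonneg.2 (not_lt.1 hP))
        have h2 := mul_pos hV (neg_pos.2 hQ)
        linarith
      · rw [hQ, mul_zero, add_zero] at hx2
        have hP := (mul_eq_zero.1 hx2).resolve_left hU.ne'
        simp only [segmentSlope] at hP hQ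
        have : b * c = a * d := by linear_combination (a + b) * hQ - (c + d) * hP
        exact absurd this hdet.ne
  have h2 : {x ∈ segmentCritical A a b B c d | 0 < segmentSlope c d x}.encard ≤ 1 := by
    rw [encard_le_one_iff]
    intro x z hx hz
    by_contra hne
    have h1 := segmentMonomial_add_lt hA hB hdet hx.1 hx.2 hz.1.1 (Ne.symm hne)
    have h2 := segmentMonomial_add_lt hA hB hdet hz.1 hz.2 hx.1.1 hne
    exact lt_asymm h1 h2
  calc _ ≤ _ := (encard_le_encard hsub).trans (encard_union_le _ _)
    _ ≤ 2 + 1 := add_le_add (encard_critical_concave_le hA hB ha hb hc hd hdet) h2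
    _ ≤ 4 := by norm_num

theorem encard_critical_le_of_opposite {A a b B c d : ℝ} (hA : 0 < A) (hB : 0 < B)
    (ha : 0 < a) (hb : 0 < b) (hc : c < 0) (hd : d < 0) :
    (segmentCritical A a b B c d).encard ≤ 4 := by
  rcases lt_trichotomy (b * c) (a * d) with h | h | h
  · exact encard_critical_le_of_opposite_of_lt hA hB ha hb hc hd h
  · exact encard_critical_le_of_proportional hA hB (fun h => ha.ne' h.1) (fun h => hc.ne h.1) h.symm
  · rw [segmentCritical_reflect]
    exact (encard_image_le _ _).trans
      (encard_critical_le_of_opposite_of_lt hA hB hb ha hd hc h)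

/-- Unless critical points occur with both sign patterns of the two slopes, they lie in one interval;
both patterns occur only if the signs of `a, b` are opposite to those of `c, d`. -/
theorem encard_critical_le {A a b B c d : ℝ} (hA : 0 < A) (hB : 0 < B)
    (hab : ¬(a = 0 ∧ b = 0)) (hcd : ¬(c = 0 ∧ d = 0))
    (hfin : (segmentCritical A a b B c d).Finite) :
    (segmentCritical A a b B c d).encard ≤ 4 := by
  by_cases hdet : a * d = b * c
  · exact encard_critical_le_of_proportional hA hB hab hcd hdet
  have hcases : ∀ x ∈ segmentCritical A a b B c d,
      (0 < segmentSlope a b x ∧ segmentSlope c d x < 0) ∨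
      (0 < segmentSlope c d x ∧ segmentSlope a b x < 0) := by
    intro x hx
    have hU := segmentMonomial_pos (a := a) (b := b) hA hx.1
    have hV := segmentMonomial_pos (a := c) (b := d) hB hx.1
    have hx2 := hx.2
    rcases lt_trichotomy (segmentSlope a b x) 0 with hP | hP | hP
    · right; refine ⟨?_, hP⟩
      by_contra hQ
      have h1 := mul_pos hU (neg_pos.2 hP)
      have h2 := mul_nonneg hV.le (neg_nonneg.2 (not_lt.1 hQ))
      linarith
    · rw [hP, mul_zero, zero_add] at hx2
      have hQ := (mul_eq_zero.1 hx2).resolve_left hV.ne'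
      simp only [segmentSlope] at hP hQ
      exact absurd (by linear_combination (c + d) * hP - (a + b) * hQ) hdet
    · left; refine ⟨hP, ?_⟩
      by_contra hQ
      have h1 := mul_pos hU hP
      have h2 := mul_nonneg hV.le (not_lt.1 hQ)
      linarith
  by_cases h1 : ∃ x ∈ segmentCritical A a b B c d, 0 < segmentSlope a b x ∧ segmentSlope c d x < 0
  · by_cases h2 : ∃ x ∈ segmentCritical A a b B c d,
        0 < segmentSlope c d x ∧ segmentSlope a b x < 0
    · obtain ⟨x, hx, hPx, hQx⟩ := h1
      obtain ⟨y, hy, hQy, hPy⟩ := h2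
      have hx0 := hx.1.1
      have hx1 := hx.1.2
      have hy0 := hy.1.1
      have hy1 := hy.1.2
      simp only [segmentSlope] at hPx hQx hPy hQy
      -- `x` and `y` lie in different components of the region where the slopes have opposite sign
      have hP : 0 < (a + b) * (y - x) := by linarith
      have hQ : 0 < (c + d) * (x - y) := by linarith
      rcases lt_trichotomy x y with hxy | hxy | hxy
      · have hab' : 0 < a + b := by
          by_contra hn; nlinarith
        have hcd' : c + d < 0 := by
          by_contra hn; nlinarith
        exact encard_critical_le_of_opposite hA hB (by nlinarith) (by nlinarith) (by nlinarith)
          (by nlinarith)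
      · simp [hxy] at hP
      · have hab' : a + b < 0 := by
          by_contra hn; nlinarith
        have hcd' : 0 < c + d := by
          by_contra hn; nlinarith
        rw [segmentCritical_swap]
        exact encard_critical_le_of_opposite hB hA (by nlinarith) (by nlinarith) (by nlinarith)
          (by nlinarith)
    · refine (encard_le_encard fun x hx => ?_).trans (encard_critical_posneg_le hA hB hfin)
      exact ⟨hx, (hcases x hx).resolve_right fun h => h2 ⟨x, hx, h⟩⟩
  · rw [segmentCritical_swap] at hfin hcases h1 ⊢
    refine (encard_le_encard fun x hx => ?_).trans (encard_critical_posneg_le hB hA hfin)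
    exact ⟨hx, (hcases x hx).resolve_left fun h => h1 ⟨x, hx, h⟩⟩

theorem encard_add_le_five {A a b B c d : ℝ} (hA : 0 < A) (hB : 0 < B)
    (hab : ¬(a = 0 ∧ b = 0)) (hcd : ¬(c = 0 ∧ d = 0)) :
    (∀ x ∈ Ioo (0 : ℝ) 1, segmentMonomial A a b x + segmentMonomial B c d x - 1 = 0) ∨
      {x ∈ Ioo (0 : ℝ) 1 | segmentMonomial A a b x + segmentMonomial B c d x - 1 = 0}.encard
        ≤ 5 := by
  have hd : ∀ x ∈ Ioo (0 : ℝ) 1, HasDerivAt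
      (fun x => segmentMonomial A a b x + segmentMonomial B c d x - 1)
      ((segmentMonomial A a b x * segmentSlope a b x +
        segmentMonomial B c d x * segmentSlope c d x) / (x * (1 - x))) x := fun x hx =>
    (((hasDerivAt_segmentMonomial A a b hx).add (hasDerivAt_segmentMonomial B c d hx)).sub_const
      1).congr_deriv (add_div _ _ _).symm
  have hz : ∀ x ∈ Ioo (0 : ℝ) 1, ((segmentMonomial A a b x * segmentSlope a b x +
        segmentMonomial B c d x * segmentSlope c d x) / (x * (1 - x)) = 0 ↔
      segmentMonomial A a b x * segmentSlope a b x +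
        segmentMonomial B c d x * segmentSlope c d x = 0) := by
    intro x hx
    rw [div_eq_zero_iff, or_iff_left]
    exact (mul_pos hx.1 (sub_pos.2 hx.2)).ne'
  have halt : (∀ x ∈ Ioo (0 : ℝ) 1, segmentMonomial A a b x * segmentSlope a b x +
        segmentMonomial B c d x * segmentSlope c d x = 0) ∨
      (segmentCritical A a b B c d).Finite := by
    have hsum : ∀ x, segmentSum (Finset.univ : Finset (Fin 2))
        ![C A * (C a * (1 - X) - C b * X), C B * (C c * (1 - X) - C d * X)] ![a, c] ![b, d] x =
        segmentMonomial A a b x * segmentSlope a b x +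
        segmentMonomial B c d x * segmentSlope c d x := by
      intro x
      simp [segmentSum, segmentMonomial, segmentSlope]
      ring
    have := zeros_segmentSum (Finset.univ : Finset (Fin 2)) 1
      ![C A * (C a * (1 - X) - C b * X), C B * (C c * (1 - X) - C d * X)] ![a, c] ![b, d]
      (by
        intro i _
        fin_cases i
        · simp; compute_degree
        · simp; compute_degree)
    simp only [hsum] at this
    refine this.imp id fun h => ?_
    refine finite_of_encard_le_coe (k := (1 + 1) * (2 ^ (Finset.univ : Finset (Fin 2)).card - 1)) ?_
    exact le_self_add.trans h
  have := zeros_alternative_of_hasDerivAt ordConnected_Ioo hd (k := 5) (by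
    refine halt.imp (fun h x hx => (hz x hx).2 (h x hx)) fun h => ?_
    have h4 := encard_critical_le hA hB hab hcd h
    calc _ ≤ (segmentCritical A a b B c d).encard + 1 := by
          gcongr
          exact fun x hx => ⟨hx.1, (hz x hx.1).1 hx.2⟩
      _ ≤ 4 + 1 := by gcongr
      _ = 5 := by norm_num)
  exact this.imp id fun h => (ENat.add_le_add_iff_right (by simp)).1 h

/-! ### Derivatives of fewnomials, isolated and non-degenerate roots -/

/-- The monomial `x ^ e = x₁ ^ e₁ ⋯ xₙ ^ eₙ`. -/
noncomputable def monomial {n : ℕ} (e x : Fin n → ℝ) : ℝ := ∏ i, x i ^ e i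

theorem eval_eq_sum {n : ℕ} (f : Fewnomial n) (x : Fin n → ℝ) :
    f.eval x = ∑ e ∈ f.support, f e * monomial e x := rfl

theorem monomial_pos {n : ℕ} (e : Fin n → ℝ) {x : Fin n → ℝ} (hx : x ∈ positiveOrthant n) :
    0 < monomial e x :=
  Finset.prod_pos fun i _ => Real.rpow_pos_of_pos (hx i) _

theorem monomial_sub {n : ℕ} (e e' : Fin n → ℝ) {x : Fin n → ℝ} (hx : x ∈ positiveOrthant n) :
    monomial (e - e') x = monomial e x / monomial e' x := by
  simp only [monomial, ← Finset.prod_div_distrib, Pi.sub_apply]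
  exact Finset.prod_congr rfl fun i _ => Real.rpow_sub (hx i) _ _

theorem monomial_smul {n : ℕ} (r : ℝ) (e : Fin n → ℝ) {x : Fin n → ℝ}
    (hx : x ∈ positiveOrthant n) : monomial (r • e) x = monomial e x ^ r := by
  simp only [monomial, Pi.smul_apply, smul_eq_mul]
  rw [← Real.finsetProd_rpow _ _ fun i _ => (Real.rpow_pos_of_pos (hx i) _).le]
  refine Finset.prod_congr rfl fun i _ => ?_
  rw [mul_comm, Real.rpow_mul (hx i).le]

/-- The curve `t ↦ (xᵢ exp (t wᵢ))ᵢ`, a line in logarithmic coordinates. -/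
noncomputable def logLine {n : ℕ} (x w : Fin n → ℝ) (t : ℝ) : Fin n → ℝ :=
  fun i => x i * Real.exp (t * w i)

theorem logLine_mem {n : ℕ} {x : Fin n → ℝ} (hx : x ∈ positiveOrthant n) (w : Fin n → ℝ) (t : ℝ) :
    logLine x w t ∈ positiveOrthant n := fun i => mul_pos (hx i) (Real.exp_pos _)

@[simp]
theorem logLine_zero {n : ℕ} (x w : Fin n → ℝ) : logLine x w 0 = x := by
  ext i; simp [logLine]

theorem monomial_logLine {n : ℕ} (e : Fin n → ℝ) {x : Fin n → ℝ} (hx : x ∈ positiveOrthant n)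
    (w : Fin n → ℝ) (t : ℝ) :
    monomial e (logLine x w t) = monomial e x * Real.exp ((e ⬝ᵥ w) * t) := by
  simp only [monomial, logLine, dotProduct, Finset.sum_mul, Real.exp_sum, ← Finset.prod_mul_distrib]
  refine Finset.prod_congr rfl fun i _ => ?_
  rw [Real.mul_rpow (hx i).le (Real.exp_pos _).le, ← Real.exp_mul]
  ring_nf

theorem continuous_logLine {n : ℕ} (x w : Fin n → ℝ) : Continuous (logLine x w) := by
  unfold logLine; fun_prop

theorem hasDerivAt_logLine {n : ℕ} (x w : Fin n → ℝ) :
    HasDerivAt (logLine x w) (fun i => x i * w i) 0 := by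
  rw [hasDerivAt_pi]
  intro i
  have := (((hasDerivAt_id (0 : ℝ)).mul_const (w i)).exp).const_mul (x i)
  refine this.congr_deriv ?_
  simp

theorem differentiableAt_eval {n : ℕ} (f : Fewnomial n) {x : Fin n → ℝ}
    (hx : x ∈ positiveOrthant n) : DifferentiableAt ℝ f.eval x := by
  have : ∀ e : Fin n → ℝ, DifferentiableAt ℝ (fun y => ∏ i, y i ^ e i) x := fun e => by
    have h := fun i (_ : i ∈ Finset.univ) =>
      ((differentiableAt_apply (𝕜 := ℝ) i x).rpow_const (p := e i) (.inl (hx i).ne')).hasFDerivAt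
    exact (HasFDerivAt.finsetProd h).differentiableAt
  unfold eval
  exact DifferentiableAt.fun_sum fun e _ => (this e).const_mul _

theorem fderiv_eval {n : ℕ} (f : Fewnomial n) {x : Fin n → ℝ} (hx : x ∈ positiveOrthant n)
    (w : Fin n → ℝ) :
    fderiv ℝ f.eval x (fun i => x i * w i) = ∑ e ∈ f.support, f e * monomial e x * (e ⬝ᵥ w) := by
  have hd : HasFDerivAt f.eval (fderiv ℝ f.eval x) (logLine x w 0) := by
    rw [logLine_zero]; exact (differentiableAt_eval f hx).hasFDerivAt
  have h1 := hd.comp_hasDerivAt 0 (hasDerivAt_logLine x w)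
  have h2 : HasDerivAt (f.eval ∘ logLine x w)
      (∑ e ∈ f.support, f e * monomial e x * (e ⬝ᵥ w)) 0 := by
    have : f.eval ∘ logLine x w =
        fun t => ∑ e ∈ f.support, f e * (monomial e x * Real.exp ((e ⬝ᵥ w) * t)) := by
      funext t
      simp only [Function.comp, eval_eq_sum, monomial_logLine _ hx]
    rw [this]
    refine HasDerivAt.fun_sum fun e _ => ?_
    have := ((((hasDerivAt_id (0 : ℝ)).const_mul (e ⬝ᵥ w)).exp).const_mul
      (monomial e x)).const_mul (f e)
    refine this.congr_deriv ?_
    simp; ring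
  exact h1.unique h2

theorem jacobian_mulVec {n : ℕ} (F : Fin n → Fewnomial n) (z v : Fin n → ℝ) (i : Fin n) :
    (jacobian F z).mulVec v i = fderiv ℝ (F i).eval z v := by
  conv_rhs => rw [pi_eq_sum_univ' v]
  simp only [Matrix.mulVec, dotProduct, jacobian, Matrix.of_apply, map_sum, map_smul, smul_eq_mul]
  refine Finset.sum_congr rfl fun j _ => ?_
  rw [mul_comm]

theorem IsArc.isPreconnected {X : Type*} [TopologicalSpace X] {A : Set X} (hA : IsArc A) :
    IsPreconnected A := by
  have key : ∀ {Y : Type} [TopologicalSpace Y] [PreconnectedSpace Y], Nonempty (Y ≃ₜ A) →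
      IsPreconnected A := by
    rintro Y _ _ ⟨e⟩
    have : A = range (fun y => (e y : X)) := by
      rw [range_comp' Subtype.val e, e.range_coe, image_univ, Subtype.range_coe]
    rw [this]
    exact isPreconnected_range (continuous_subtype_val.comp e.continuous)
  have hp : ∀ s : Set ℝ, s.OrdConnected → PreconnectedSpace s := fun s hs =>
    isPreconnected_iff_preconnectedSpace.1 hs.isPreconnected
  rcases hA with ⟨x, rfl⟩ | h | h | h | h
  · exact isPreconnected_singleton
  · exact key h
  · have := hp _ (ordConnected_Ioo (a := (0 : ℝ)) (b := 1)); exact key h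
  · have := hp _ (ordConnected_Icc (a := (0 : ℝ)) (b := 1)); exact key h
  · have := hp _ (ordConnected_Ico (a := (0 : ℝ)) (b := 1)); exact key h

theorem isIsolatedRoot_of_eventually {n : ℕ} {F : Fin n → Fewnomial n} {z : Fin n → ℝ}
    (hz : z ∈ roots F) (h : ∀ᶠ x in 𝓝[≠] z, x ∉ roots F) : IsIsolatedRoot F z := by
  refine ⟨hz, fun A hA hAF hzA => ?_⟩
  by_contra hne
  have hnt : A.Nontrivial := by
    by_contra hs
    exact hne ((not_nontrivial_iff.1 hs).eq_singleton_of_mem hzA)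
  have := hA.isPreconnected.preperfect_of_nontrivial hnt z hzA
  rw [accPt_iff_frequently_nhdsNE] at this
  exact this (h.mono fun x hx hxA => hx (hAF hxA))

theorem isIsolatedRoot_of_finite {n : ℕ} {F : Fin n → Fewnomial n} (hF : (roots F).Finite)
    {z : Fin n → ℝ} (hz : z ∈ roots F) : IsIsolatedRoot F z := by
  refine isIsolatedRoot_of_eventually hz ?_
  have : (roots F \ {z})ᶜ ∈ 𝓝 z := (hF.subset sdiff_subset).isClosed.isOpen_compl.mem_nhds (by simp)
  rw [eventually_nhdsWithin_iff]
  filter_upwards [this] with x hx hxz hxF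
  exact hx ⟨hxF, hxz⟩

theorem IsNondegenerateRoot.isIsolatedRoot {n : ℕ} {F : Fin n → Fewnomial n} {z : Fin n → ℝ}
    (h : IsNondegenerateRoot F z) : IsIsolatedRoot F z := by
  obtain ⟨hz, hr⟩ := h
  refine isIsolatedRoot_of_eventually hz ?_
  have hd : HasFDerivAt (fun x i => (F i).eval x)
      (ContinuousLinearMap.pi fun i => fderiv ℝ (F i).eval z) z :=
    hasFDerivAt_pi.2 fun i => (differentiableAt_eval (F i) hz.1).hasFDerivAt
  have hker : (LinearMap.ker (jacobian F z).mulVecLin) = ⊥ := by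
    have h1 := LinearMap.finrank_range_add_finrank_ker (jacobian F z).mulVecLin
    rw [Matrix.rank] at hr
    rw [hr, Module.finrank_fin_fun] at h1
    exact Submodule.finrank_eq_zero.1 (by omega)
  have hker' : LinearMap.ker
      (ContinuousLinearMap.pi fun i => fderiv ℝ (F i).eval z).toLinearMap = ⊥ := by
    rw [← hker]
    congr 1
    ext1 v
    ext i
    simp [jacobian_mulVec]
  obtain ⟨K, -, hK⟩ := LinearMap.exists_antilipschitzWith _ hker'
  have := hd.eventually_ne (c := 0) ⟨K, hK⟩
  filter_upwards [this] with x hx hxF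
  exact hx (funext fun i => hxF.2 i)

theorem maxNondegenerate_le_maxIsolated {n : ℕ} (m : Fin n → ℕ) :
    maxNondegenerate m ≤ maxIsolated m :=
  iSup₂_mono fun _ _ => encard_le_encard fun _ h => h.isIsolatedRoot

/-- The closed interval of roots given by `γ` is an arc. -/
theorem not_isIsolatedRoot_of_curve {n : ℕ} {F : Fin n → Fewnomial n} {γ : ℝ → Fin n → ℝ} {u v : ℝ}
    (huv : u < v) (hc : ContinuousOn γ (Icc u v)) (hi : InjOn γ (Icc u v))
    (hr : ∀ t ∈ Icc u v, γ t ∈ roots F) : ¬ IsIsolatedRoot F (γ u) := by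
  rintro ⟨-, h⟩
  have hu : u ∈ Icc u v := left_mem_Icc.2 huv.le
  have hv : v ∈ Icc u v := right_mem_Icc.2 huv.le
  have harc : IsArc (γ '' Icc u v) := by
    right; right; right; left
    refine ⟨(iccHomeoI u v huv).symm.trans ?_⟩
    exact Continuous.homeoOfEquivCompactToT2 (f := Equiv.Set.imageOfInjOn γ (Icc u v) hi)
      (by
        refine Continuous.subtype_mk ?_ _
        exact continuousOn_iff_continuous_domRestrict.1 hc)
  have := h _ harc (by rintro _ ⟨t, ht, rfl⟩; exact hr t ht) (mem_image_of_mem γ hu)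
  have hvm : γ v ∈ γ '' Icc u v := mem_image_of_mem γ hv
  rw [this, mem_singleton_iff] at hvm
  exact huv.ne' (hi hv hu hvm)

/-- A root of two equations is non-degenerate as soon as the second gradient does not vanish on some
vector orthogonal to a non-zero first gradient. -/
theorem isNondegenerateRoot_of_fderiv {F : Fin 2 → Fewnomial 2} {z v w : Fin 2 → ℝ}
    (hz : z ∈ roots F) (h0v : fderiv ℝ (F 0).eval z v ≠ 0) (h0w : fderiv ℝ (F 0).eval z w = 0)
    (h1w : fderiv ℝ (F 1).eval z w ≠ 0) : IsNondegenerateRoot F z := by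
  suffices hdet : (jacobian F z).det ≠ 0 from
    ⟨hz, (Matrix.rank_of_det_ne_zero hdet).trans (Fintype.card_fin 2)⟩
  intro hdet
  have hmul : (jacobian F z * Matrix.of ![![v 0, w 0], ![v 1, w 1]]) =
      Matrix.of ![![fderiv ℝ (F 0).eval z v, fderiv ℝ (F 0).eval z w],
        ![fderiv ℝ (F 1).eval z v, fderiv ℝ (F 1).eval z w]] := by
    simp only [← jacobian_mulVec]
    ext i j
    fin_cases i <;> fin_cases j <;>
      simp [Matrix.mul_apply, Matrix.mulVec, dotProduct, Fin.sum_univ_two]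
  have := congrArg Matrix.det hmul
  rw [Matrix.det_mul, hdet, zero_mul, Matrix.det_fin_two] at this
  simp [h0w] at this
  exact this.elim h0v h1w

/-! ### Collinear exponents -/

theorem log_monomial {n : ℕ} (e : Fin n → ℝ) {x : Fin n → ℝ} (hx : x ∈ positiveOrthant n) :
    Real.log (monomial e x) = e ⬝ᵥ fun i => Real.log (x i) := by
  rw [monomial, Real.log_prod fun i _ => (Real.rpow_pos_of_pos (hx i) _).ne']
  exact Finset.sum_congr rfl fun i _ => Real.log_rpow (hx i) _

theorem eval_trinomial {n : ℕ} {f : Fewnomial n} {p q r : Fin n → ℝ} (hpq : p ≠ q) (hpr : p ≠ r)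
    (hqr : q ≠ r) (hf : f.support = {p, q, r}) {x : Fin n → ℝ} (hx : x ∈ positiveOrthant n) :
    f.eval x = monomial r x * (f p * monomial (p - r) x + f q * monomial (q - r) x + f r) := by
  have hr := (monomial_pos r hx).ne'
  rw [eval_eq_sum, hf, Finset.sum_insert (by simp [hpq, hpr]), Finset.sum_pair hqr,
    monomial_sub _ _ hx, monomial_sub _ _ hx]
  field_simp
  ring

theorem not_forall_exp_add_exp_add_const_eq_zero {A B D k : ℝ} (hB : B ≠ 0) (hk0 : k ≠ 0)
    (hk1 : k ≠ 1) : ¬ ∀ t : ℝ, A * Real.exp (1 * t) + B * Real.exp (k * t) + D = 0 := by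
  intro h
  have hexp : ∀ (c l t : ℝ), HasDerivAt (fun t => c * Real.exp (l * t))
      (c * l * Real.exp (l * t)) t := fun c l t => by
    refine ((((hasDerivAt_id t).const_mul l).exp).const_mul c).congr_deriv ?_
    simp only [id]; ring
  have h1 : ∀ t : ℝ, A * 1 * Real.exp (1 * t) + B * k * Real.exp (k * t) = 0 := fun t => by
    have h2 := ((hexp A 1 t).add (hexp B k t)).add_const D
    have h3 : HasDerivAt (fun _ : ℝ => (0 : ℝ)) _ t := h2.congr_of_eventuallyEq
      (.of_forall fun s => (h s).symm)
    exact h3.unique (hasDerivAt_const t 0)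
  have h2 : A * 1 * 1 * Real.exp (1 * 0) + B * k * k * Real.exp (k * 0) = 0 := by
    have h2 := (hexp (A * 1) 1 0).add (hexp (B * k) k 0)
    have h3 : HasDerivAt (fun _ : ℝ => (0 : ℝ)) _ 0 := h2.congr_of_eventuallyEq
      (.of_forall fun s => (h1 s).symm)
    exact h3.unique (hasDerivAt_const 0 0)
  have h10 := h1 0
  simp only [mul_zero, Real.exp_zero, mul_one] at h10 h2
  have : B * (k * (k - 1)) = 0 := by linarith
  exact mul_ne_zero hB (mul_ne_zero hk0 (sub_ne_zero.2 hk1)) this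

theorem exists_logLine_eq {e x z : Fin 2 → ℝ} (he : e ≠ 0) (hx : x ∈ positiveOrthant 2)
    (hz : z ∈ positiveOrthant 2) (h : monomial e x = monomial e z) :
    ∃ t, logLine z ![-e 1, e 0] t = x := by
  have h1 := congrArg Real.log h
  rw [log_monomial e hx, log_monomial e hz] at h1
  simp only [dotProduct, Fin.sum_univ_two] at h1
  have hN : e 1 ^ 2 + e 0 ^ 2 ≠ 0 := by
    intro h0
    refine he (funext fun i => ?_)
    fin_cases i
    · change e 0 = 0; nlinarith [sq_nonneg (e 0), sq_nonneg (e 1)]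
    · change e 1 = 0; nlinarith [sq_nonneg (e 0), sq_nonneg (e 1)]
  refine ⟨(-e 1 * (Real.log (x 0) - Real.log (z 0)) + e 0 * (Real.log (x 1) - Real.log (z 1))) /
    (e 1 ^ 2 + e 0 ^ 2), ?_⟩
  have key : ∀ i, logLine z ![-e 1, e 0]
      ((-e 1 * (Real.log (x 0) - Real.log (z 0)) + e 0 * (Real.log (x 1) - Real.log (z 1))) /
    (e 1 ^ 2 + e 0 ^ 2)) i = Real.exp (Real.log (x i)) := by
    intro i
    rw [logLine, ← Real.exp_log (hz i), ← Real.exp_add, Real.exp_eq_exp]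
    fin_cases i
    · simp only [Fin.zero_eta, Matrix.cons_val_zero]
      field_simp
      linear_combination (-e 0) * h1
    · simp only [Fin.mk_one, Matrix.cons_val_one, Matrix.cons_val_fin_one]
      field_simp
      linear_combination (-e 1) * h1
  exact funext fun i => (key i).trans (Real.exp_log (hx i))

theorem injective_logLine {n : ℕ} {z w : Fin n → ℝ} (hz : z ∈ positiveOrthant n) (hw : w ≠ 0) :
    Function.Injective (logLine z w) := by
  intro s t h
  obtain ⟨i, hi⟩ := Function.ne_iff.1 hw
  have := mul_left_cancel₀ (hz i).ne' (congrFun h i)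
  exact mul_right_cancel₀ hi (Real.exp_injective this)

/-- If the exponents of the trinomial are collinear, its zero set consists of at most two
lines in logarithmic coordinates, on each of which the second equation is an exponential sum. -/
theorem encard_isolated_le_of_collinear {F : Fin 2 → Fewnomial 2} {p q r : Fin 2 → ℝ} {m : ℕ}
    (hpq : p ≠ q) (hpr : p ≠ r) (hqr : q ≠ r) (hf : (F 0).support = {p, q, r})
    (hm : (F 1).support.card = m + 1)
    (hdet : (p 0 - r 0) * (q 1 - r 1) = (p 1 - r 1) * (q 0 - r 0)) :
    {z | IsIsolatedRoot F z}.encard ≤ (2 * m : ℕ) := by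
  have he0 : p - r ≠ 0 := sub_ne_zero.2 hpr
  obtain ⟨k, hk⟩ : ∃ k : ℝ, q - r = k • (p - r) := by
    by_cases h0 : p 0 - r 0 = 0
    · have h1 : p 1 - r 1 ≠ 0 := fun h1 => he0 (funext fun i => by fin_cases i <;> assumption)
      have h2 : q 0 - r 0 = 0 := by
        rw [h0, zero_mul, eq_comm, mul_eq_zero] at hdet
        exact hdet.resolve_left h1
      refine ⟨(q 1 - r 1) / (p 1 - r 1), funext fun i => ?_⟩
      fin_cases i
      · simp [h0, h2]
      · simp; field_simp
    · refine ⟨(q 0 - r 0) / (p 0 - r 0), funext fun i => ?_⟩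
      fin_cases i
      · simp; field_simp
      · simp; field_simp; linarith
  have hk0 : k ≠ 0 := by rintro rfl; exact hqr (sub_eq_zero.1 (by simpa using hk))
  have hk1 : k ≠ 1 := by rintro rfl; exact hpq (by simpa using hk.symm)
  set e := p - r with he
  set A := F 0 p
  set B := F 0 q
  set D := F 0 r
  have hB : B ≠ 0 := Finsupp.mem_support_iff.1 (by rw [hf]; simp)
  -- the first equation in terms of `log x ^ e`
  have hzero : ∀ x ∈ positiveOrthant 2, ((F 0).eval x = 0 ↔
      A * Real.exp (1 * Real.log (monomial e x)) + B * Real.exp (k * Real.log (monomial e x)) + D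
        = 0) := by
    intro x hx
    have hpos := monomial_pos e hx
    rw [eval_trinomial hpq hpr hqr hf hx, mul_eq_zero, or_iff_right (monomial_pos r hx).ne', hk,
      monomial_smul k e hx, one_mul, Real.exp_log hpos, mul_comm k, Real.rpow_def_of_pos hpos]
  set T : Set ℝ := {t | A * Real.exp (1 * t) + B * Real.exp (k * t) + D = 0} with hT
  have hT2 : T.encard ≤ 2 := by
    have h := zeros_expSum (Finset.univ : Finset (Fin 3)) ![A, B, D] ![1, k, 0]
    have e : ∀ t, ∑ i : Fin 3, ![A, B, D] i * Real.exp (![1, k, 0] i * t) =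
        A * Real.exp (1 * t) + B * Real.exp (k * t) + D := fun t => by
      simp [Fin.sum_univ_three]
    simp only [e] at h
    have h3 := h.resolve_left (not_forall_exp_add_exp_add_const_eq_zero hB hk0 hk1)
    have : T.encard + 1 ≤ 2 + 1 := h3.trans_eq (by norm_num)
    exact (ENat.add_le_add_iff_right (by simp)).1 this
  have hfib : ∀ t, {z | IsIsolatedRoot F z ∧ Real.log (monomial e z) = t}.encard ≤ m := by
    intro t
    rcases {z | IsIsolatedRoot F z ∧ Real.log (monomial e z) = t}.eq_empty_or_nonempty with h0 | h0
    · simp [h0]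
    obtain ⟨z, hz, hzt⟩ := h0
    have hzp := hz.1.1
    have hw : ![-e 1, e 0] ≠ 0 := by
      intro h
      refine he0 (funext fun i => ?_)
      have h1 := congrFun h 0
      have h2 := congrFun h 1
      simp only [Matrix.cons_val_zero, Matrix.cons_val_one, Pi.zero_apply, neg_eq_zero] at h1 h2
      fin_cases i <;> assumption
    have hline : ∀ s, (F 1).eval (logLine z ![-e 1, e 0] s) = ∑ i ∈ (F 1).support,
        (F 1 i * monomial i z) * Real.exp ((i ⬝ᵥ ![-e 1, e 0]) * s) := fun s => by
      rw [eval_eq_sum]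
      simp only [monomial_logLine _ hzp, mul_assoc]
    rcases zeros_expSum (F 1).support (fun i => F 1 i * monomial i z)
      (fun i => i ⬝ᵥ ![-e 1, e 0]) with h | h
    · refine absurd hz ?_
      have := not_isIsolatedRoot_of_curve (F := F) (γ := logLine z ![-e 1, e 0]) one_pos
        (continuous_logLine _ _).continuousOn (injective_logLine hzp hw).injOn fun s _ => by
          refine ⟨logLine_mem hzp _ s, Fin.forall_fin_two.2 ⟨?_, ?_⟩⟩
          · rw [hzero _ (logLine_mem hzp _ s), monomial_logLine e hzp]
            have : e ⬝ᵥ ![-e 1, e 0] = 0 := by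
              simp [dotProduct, Fin.sum_univ_two]; ring
            rw [this, zero_mul, Real.exp_zero, mul_one, ← hzero z hzp]
            exact hz.1.2 0
          · rw [hline]; exact h s
      simpa using this
    · rw [hm] at h
      have h' : {s : ℝ | ∑ i ∈ (F 1).support, F 1 i * monomial i z *
          Real.exp (i ⬝ᵥ ![-e 1, e 0] * s) = 0}.encard ≤ m :=
        (ENat.add_le_add_iff_right (by simp)).1 (h.trans_eq (by push_cast; rfl))
      refine le_trans ((encard_le_encard ?_).trans
        (encard_image_le (logLine z ![-e 1, e 0]) _)) h'
      rintro x ⟨hx, hxt⟩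
      obtain ⟨s, rfl⟩ := exists_logLine_eq he0 hx.1.1 hzp
        (Real.log_injOn_pos (monomial_pos e hx.1.1) (monomial_pos e hzp) (hxt.trans hzt.symm))
      exact ⟨s, (hline s).symm.trans (hx.1.2 1), rfl⟩
  have hTf : T.Finite := finite_of_encard_le_coe (k := 2) hT2
  have hsub : {z | IsIsolatedRoot F z} ⊆ ⋃ t ∈ hTf.toFinset,
      {z | IsIsolatedRoot F z ∧ Real.log (monomial e z) = t} := by
    intro z hz
    simp only [mem_iUnion, Finite.mem_toFinset]
    exact ⟨_, (hzero z hz.1.1).1 (hz.1.2 0), hz, rfl⟩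
  have hcard : hTf.toFinset.card ≤ 2 := by
    rw [hTf.encard_eq_coe_toFinset_card] at hT2; exact_mod_cast hT2
  calc _ ≤ _ := encard_le_encard hsub
    _ ≤ ∑ t ∈ hTf.toFinset, {z | IsIsolatedRoot F z ∧ Real.log (monomial e z) = t}.encard :=
        Finset.set_encard_biUnion_le _ _
    _ ≤ ∑ t ∈ hTf.toFinset, (m : ℕ∞) := Finset.sum_le_sum fun t _ => hfib t
    _ = (hTf.toFinset.card * m : ℕ) := by simp
    _ ≤ (2 * m : ℕ) := by exact_mod_cast Nat.mul_le_mul_right m hcard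

/-! ### Systems in separated variables -/

/-- The exponent vector of the `k`-th power of the `i`-th variable. -/
noncomputable def powerExponent {n : ℕ} (i : Fin n) : ℕ ↪ (Fin n → ℝ) where
  toFun k := Pi.single i (k : ℝ)
  inj' _ _ h := Nat.cast_injective (Pi.single_injective i h)

theorem prod_rpow_powerExponent {n : ℕ} (i : Fin n) (k : ℕ) (x : Fin n → ℝ) :
    ∏ j, x j ^ powerExponent i k j = x i ^ k := by
  change ∏ j, x j ^ (Pi.single i (k : ℝ) : Fin n → ℝ) j = x i ^ k
  rw [Finset.prod_eq_single i]
  · simp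
  · intro j _ hj; simp [Pi.single_eq_of_ne hj]
  · simp

/-- A univariate polynomial as a fewnomial in the `i`-th variable. -/
noncomputable def ofPolynomial {n : ℕ} (i : Fin n) (P : ℝ[X]) : Fewnomial n :=
  Finsupp.embDomain (powerExponent i) ⟨P.support, P.coeff, fun _ => mem_support_iff⟩

theorem card_support_ofPolynomial {n : ℕ} (i : Fin n) (P : ℝ[X]) :
    (ofPolynomial i P).support.card = P.support.card := by
  rw [ofPolynomial, Finsupp.support_embDomain, Finset.card_map]

theorem eval_ofPolynomial {n : ℕ} (i : Fin n) (P : ℝ[X]) :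
    (ofPolynomial i P).eval = fun x => P.eval (x i) := by
  funext x
  rw [eval, ofPolynomial, Finsupp.support_embDomain, Finset.sum_map, Polynomial.eval_eq_sum, Polynomial.sum]
  refine Finset.sum_congr rfl fun k _ => ?_
  rw [Finsupp.embDomain_apply_self, prod_rpow_powerExponent]
  rfl

theorem fderiv_eval_ofPolynomial {n : ℕ} (i : Fin n) (P : ℝ[X]) (z v : Fin n → ℝ) :
    fderiv ℝ (ofPolynomial i P).eval z v = (derivative P).eval (z i) * v i := by
  rw [eval_ofPolynomial]
  have h := (P.hasDerivAt (z i)).comp_hasFDerivAt z (hasFDerivAt_apply (𝕜 := ℝ) i z)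
  have h' : HasFDerivAt (fun x : Fin n → ℝ => P.eval (x i)) _ z := h
  rw [h'.fderiv]
  simp

/-- `(X - 1) (X - 2) ⋯ (X - d)`. -/
noncomputable def consecutiveRoots (d : ℕ) : ℝ[X] :=
  ∏ j ∈ Finset.range d, (X - C ((j : ℝ) + 1))

/-- The coefficients alternate in sign; in particular none of them vanishes. -/
theorem coeff_consecutiveRoots (d k : ℕ) :
    (d < k → (consecutiveRoots d).coeff k = 0) ∧
      (k ≤ d → 0 < (-1) ^ (d + k) * (consecutiveRoots d).coeff k) := by
  induction d generalizing k with
  | zero =>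
    refine ⟨fun h => ?_, fun h => ?_⟩
    · simp [consecutiveRoots, coeff_one, h.ne']
    · simp [consecutiveRoots, Nat.le_zero.1 h]
  | succ d ih =>
    have hs : consecutiveRoots (d + 1) = consecutiveRoots d * (X - C ((d : ℝ) + 1)) :=
      Finset.prod_range_succ _ _
    rw [hs]
    have hd : (0 : ℝ) < (d : ℝ) + 1 := by positivity
    cases k with
    | zero =>
      refine ⟨fun h => by simp at h, fun _ => ?_⟩
      have := mul_pos ((ih 0).2 (Nat.zero_le _)) hd
      rw [mul_coeff_zero]
      simp only [coeff_sub, coeff_X_zero, coeff_C_zero, pow_succ, add_zero] at this ⊢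
      linarith
    | succ k =>
      rw [coeff_mul_X_sub_C]
      refine ⟨fun h => ?_, fun h => ?_⟩
      · rw [(ih k).1 (by omega), (ih (k + 1)).1 (by omega)]; simp
      · have h1 := (ih k).2 (by omega)
        have h2 : 0 ≤ (-1) ^ (d + (k + 1)) * (consecutiveRoots d).coeff (k + 1) := by
          rcases Nat.lt_or_ge d (k + 1) with hk | hk
          · rw [(ih (k + 1)).1 hk, mul_zero]
          · exact ((ih (k + 1)).2 hk).le
        have h3 := mul_nonneg h2 hd.le
        have e1 : (-1 : ℝ) ^ (d + 1 + (k + 1)) = (-1) ^ (d + k) := by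
          rw [show d + 1 + (k + 1) = d + k + 2 by ring, pow_add]; simp
        have e2 : (-1 : ℝ) ^ (d + (k + 1)) = -(-1) ^ (d + k) := by
          rw [← add_assoc, pow_succ]; simp
        rw [e2] at h3
        rw [e1]
        linarith

theorem card_support_consecutiveRoots (d : ℕ) : (consecutiveRoots d).support.card = d + 1 := by
  have : (consecutiveRoots d).support = Finset.range (d + 1) := by
    ext k
    rw [mem_support_iff, Finset.mem_range]
    constructor
    · intro h
      by_contra hk
      exact h ((coeff_consecutiveRoots d k).1 (by omega))
    · intro hk h
      have := (coeff_consecutiveRoots d k).2 (by omega)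
      simp [h] at this
  rw [this, Finset.card_range]

theorem eval_consecutiveRoots {d j : ℕ} (hj : j < d) :
    (consecutiveRoots d).eval ((j : ℝ) + 1) = 0 := by
  rw [consecutiveRoots, eval_prod]
  exact Finset.prod_eq_zero (Finset.mem_range.2 hj) (by simp)

theorem eval_derivative_consecutiveRoots {d j : ℕ} (hj : j < d) :
    (derivative (consecutiveRoots d)).eval ((j : ℝ) + 1) ≠ 0 := by
  have hsep : (consecutiveRoots d).Separable := by
    unfold consecutiveRoots
    refine separable_prod_X_sub_C_iff'.2 fun x _ y _ h => ?_
    simpa using h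
  exact hsep.eval₂_derivative_ne_zero (RingHom.id ℝ) (by simpa using eval_consecutiveRoots hj)

/-- `(x - 1) (x - 2) = 0 = (y - 1) ⋯ (y - m)` has `2 m` non-degenerate roots. -/
theorem two_mul_le_maxNondegenerate (m : ℕ) :
    ((2 * m : ℕ) : ℕ∞) ≤ maxNondegenerate ![3, m + 1] := by
  set F : Fin 2 → Fewnomial 2 :=
    ![ofPolynomial 0 (consecutiveRoots 2), ofPolynomial 1 (consecutiveRoots m)] with hF
  have htype : IsOfType F ![3, m + 1] := by
    refine Fin.forall_fin_two.2 ⟨⟨by simp, ?_⟩, ⟨by simp, ?_⟩⟩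
    · simp [F, card_support_ofPolynomial, card_support_consecutiveRoots]
    · simp [F, card_support_ofPolynomial, card_support_consecutiveRoots]
  let g : ℕ × ℕ → Fin 2 → ℝ := fun ij => ![(ij.1 : ℝ) + 1, (ij.2 : ℝ) + 1]
  have hg : Function.Injective g := by
    rintro ⟨i, j⟩ ⟨i', j'⟩ h
    have h0 := congrFun h 0
    have h1 := congrFun h 1
    simp only [g, Matrix.cons_val_zero, Matrix.cons_val_one, add_left_inj, Nat.cast_inj] at h0 h1
    rw [h0, h1]
  have hsub : g '' (Finset.range 2 ×ˢ Finset.range m : Finset (ℕ × ℕ)) ⊆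
      {z | IsNondegenerateRoot F z} := by
    rintro _ ⟨⟨i, j⟩, hij, rfl⟩
    simp only [Finset.coe_product, mem_prod, Finset.mem_coe, Finset.mem_range] at hij
    refine isNondegenerateRoot_of_fderiv (v := Pi.single 0 1) (w := Pi.single 1 1) ⟨?_, ?_⟩ ?_ ?_ ?_
    · refine Fin.forall_fin_two.2 ⟨?_, ?_⟩ <;> simp only [g, Matrix.cons_val_zero,
        Matrix.cons_val_one] <;> positivity
    · refine Fin.forall_fin_two.2 ⟨?_, ?_⟩
      · simpa [F, g, eval_ofPolynomial] using eval_consecutiveRoots hij.1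
      · simpa [F, g, eval_ofPolynomial] using eval_consecutiveRoots hij.2
    · simpa [F, g, fderiv_eval_ofPolynomial] using eval_derivative_consecutiveRoots hij.1
    · simp [F, fderiv_eval_ofPolynomial]
    · simpa [F, g, fderiv_eval_ofPolynomial] using eval_derivative_consecutiveRoots hij.2
  calc ((2 * m : ℕ) : ℕ∞) =
      (g '' (Finset.range 2 ×ˢ Finset.range m : Finset (ℕ × ℕ))).encard := by
        rw [hg.encard_image, encard_coe_eq_coe_finsetCard]; simp
    _ ≤ _ := encard_le_encard hsub
    _ ≤ _ := le_iSup₂_of_le F htype le_rfl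

/-! ### Trinomial curves as segments -/

/-- A trinomial without sign changes has no positive zeros; otherwise the exponents can be listed so
that the last coefficient has the sign opposite to the other two. -/
theorem trinomial_sign_cases {n : ℕ} (f : Fewnomial n) (hf : f.support.card = 3) :
    (∀ x ∈ positiveOrthant n, f.eval x ≠ 0) ∨
    ∃ p q r, p ≠ q ∧ p ≠ r ∧ q ≠ r ∧ f.support = {p, q, r} ∧ f p * f r < 0 ∧ f q * f r < 0 := by
  obtain ⟨p, q, r, hpq, hpr, hqr, hs⟩ := Finset.card_eq_three.1 hf
  have hp : f p ≠ 0 := Finsupp.mem_support_iff.1 (by rw [hs]; simp)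
  have hq : f q ≠ 0 := Finsupp.mem_support_iff.1 (by rw [hs]; simp)
  have hr : f r ≠ 0 := Finsupp.mem_support_iff.1 (by rw [hs]; simp)
  have hev : ∀ x, f.eval x = f p * monomial p x + (f q * monomial q x + f r * monomial r x) := by
    intro x
    rw [eval_eq_sum, hs, Finset.sum_insert (by simp [hpq, hpr]), Finset.sum_pair hqr]
  have hs2 : f.support = {p, r, q} := by rw [hs, Finset.pair_comm q r]
  have hs3 : f.support = {q, r, p} := by
    rw [hs]; ext; simp only [Finset.mem_insert, Finset.mem_singleton]; tauto
  rcases lt_or_gt_of_ne hp with hp | hp <;> rcases lt_or_gt_of_ne hq with hq | hq <;>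
    rcases lt_or_gt_of_ne hr with hr | hr
  · left; intro x hx
    rw [hev]
    have h1 := mul_neg_of_neg_of_pos hp (monomial_pos p hx)
    have h2 := mul_neg_of_neg_of_pos hq (monomial_pos q hx)
    have h3 := mul_neg_of_neg_of_pos hr (monomial_pos r hx)
    linarith
  · exact .inr ⟨p, q, r, hpq, hpr, hqr, hs, mul_neg_of_neg_of_pos hp hr,
      mul_neg_of_neg_of_pos hq hr⟩
  · exact .inr ⟨p, r, q, hpr, hpq, hqr.symm, hs2, mul_neg_of_neg_of_pos hp hq,
      mul_neg_of_neg_of_pos hr hq⟩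
  · exact .inr ⟨q, r, p, hqr, hpq.symm, hpr.symm, hs3, mul_neg_of_pos_of_neg hq hp,
      mul_neg_of_pos_of_neg hr hp⟩
  · exact .inr ⟨q, r, p, hqr, hpq.symm, hpr.symm, hs3, mul_neg_of_neg_of_pos hq hp,
      mul_neg_of_neg_of_pos hr hp⟩
  · exact .inr ⟨p, r, q, hpr, hpq, hqr.symm, hs2, mul_neg_of_pos_of_neg hp hq,
      mul_neg_of_pos_of_neg hr hq⟩
  · exact .inr ⟨p, q, r, hpq, hpr, hqr, hs, mul_neg_of_pos_of_neg hp hr,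
      mul_neg_of_pos_of_neg hq hr⟩
  · left; intro x hx
    rw [hev]
    have h1 := mul_pos hp (monomial_pos p hx)
    have h2 := mul_pos hq (monomial_pos q hx)
    have h3 := mul_pos hr (monomial_pos r hx)
    linarith

/-- A regular parametrization by `(0, 1)` of the positive zero set of `f` in which every monomial
`x ^ e` becomes a multiple of `s ^ a (1 - s) ^ b`, with different exponents for different `e`. -/
structure SegmentParametrization (f : Fewnomial 2) where
  /-- The parametrization, of interest on `(0, 1)` only. -/
  curve : ℝ → Fin 2 → ℝ
  /-- The exponent of `s` in `x ^ e`. -/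
  left : (Fin 2 → ℝ) → ℝ
  /-- The exponent of `1 - s` in `x ^ e`. -/
  right : (Fin 2 → ℝ) → ℝ
  /-- The constant factor in `x ^ e`. -/
  scale : (Fin 2 → ℝ) → ℝ
  scale_pos : ∀ e, 0 < scale e
  ext_exponent : ∀ e e', left e = left e' → right e = right e' → e = e'
  mem : ∀ s ∈ Ioo (0 : ℝ) 1, curve s ∈ positiveOrthant 2
  eval_curve : ∀ s ∈ Ioo (0 : ℝ) 1, f.eval (curve s) = 0
  surj : ∀ x ∈ positiveOrthant 2, f.eval x = 0 → ∃ s ∈ Ioo (0 : ℝ) 1, curve s = x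
  injOn : InjOn curve (Ioo 0 1)
  differentiableAt : ∀ s ∈ Ioo (0 : ℝ) 1, DifferentiableAt ℝ curve s
  monomial_curve : ∀ e, ∀ s ∈ Ioo (0 : ℝ) 1,
    monomial e (curve s) = scale e * (s ^ left e * (1 - s) ^ right e)
  regular : ∀ x ∈ positiveOrthant 2, f.eval x = 0 → ∃ v, fderiv ℝ f.eval x v ≠ 0

theorem exp_mul_log_sub_log {s α : ℝ} (hs : 0 < s) (a : ℝ) :
    Real.exp (a * (Real.log s - Real.log α)) = Real.exp (-(a * Real.log α)) * s ^ a := by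
  rw [Real.rpow_def_of_pos hs, ← Real.exp_add]; ring_nf

theorem nonempty_segmentParametrization {f : Fewnomial 2} {p q r : Fin 2 → ℝ}
    (hpq : p ≠ q) (hpr : p ≠ r) (hqr : q ≠ r) (hf : f.support = {p, q, r})
    (hp : f p * f r < 0) (hq : f q * f r < 0)
    (hdet : (p 0 - r 0) * (q 1 - r 1) ≠ (p 1 - r 1) * (q 0 - r 0)) :
    Nonempty (SegmentParametrization f) := by
  have hr : f r ≠ 0 := fun h => by simp [h] at hp
  -- `α x ^ (p - r) + β x ^ (q - r) = 1` is the equation of the curve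
  set α := -f p / f r with hα
  set β := -f q / f r with hβ
  have hα0 : 0 < α := by
    have : α = -(f p * f r) / f r ^ 2 := by rw [hα]; field_simp
    rw [this]; exact div_pos (neg_pos.2 hp) (by positivity)
  have hβ0 : 0 < β := by
    have : β = -(f q * f r) / f r ^ 2 := by rw [hβ]; field_simp
    rw [this]; exact div_pos (neg_pos.2 hq) (by positivity)
  have hzero : ∀ x ∈ positiveOrthant 2, (f.eval x = 0 ↔
      α * monomial (p - r) x + β * monomial (q - r) x = 1) := by
    intro x hx
    rw [eval_trinomial hpq hpr hqr hf hx, mul_eq_zero, or_iff_right (monomial_pos r hx).ne', hα, hβ]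
    field_simp
    constructor <;> intro h <;> linarith
  set p0 := p 0 - r 0 with hp0
  set p1 := p 1 - r 1 with hp1
  set q0 := q 0 - r 0 with hq0
  set q1 := q 1 - r 1 with hq1
  set D := p0 * q1 - p1 * q0 with hD
  have hD0 : D ≠ 0 := sub_ne_zero.2 hdet
  -- in logarithmic coordinates the curve is a linear image of `(log s, log (1 - s))`
  let L : ℝ → ℝ := fun s => Real.log s - Real.log α
  let R : ℝ → ℝ := fun s => Real.log (1 - s) - Real.log β
  let θ : ℝ → Fin 2 → ℝ := fun s => ![Real.exp ((q1 * L s - p1 * R s) / D),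
    Real.exp ((p0 * R s - q0 * L s) / D)]
  have hθ : ∀ s, θ s ∈ positiveOrthant 2 := fun s =>
    Fin.forall_fin_two.2 ⟨Real.exp_pos _, Real.exp_pos _⟩
  let lft : (Fin 2 → ℝ) → ℝ := fun e => (e 0 * q1 - e 1 * q0) / D
  let rgt : (Fin 2 → ℝ) → ℝ := fun e => (e 1 * p0 - e 0 * p1) / D
  let sc : (Fin 2 → ℝ) → ℝ := fun e =>
    Real.exp (-(lft e * Real.log α)) * Real.exp (-(rgt e * Real.log β))
  have hmon : ∀ e, ∀ s ∈ Ioo (0 : ℝ) 1,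
      monomial e (θ s) = sc e * (s ^ lft e * (1 - s) ^ rgt e) := by
    intro e s hs
    have h1 := exp_mul_log_sub_log (α := α) hs.1 (lft e)
    have h2 := exp_mul_log_sub_log (α := β) (sub_pos.2 hs.2) (rgt e)
    have h3 : monomial e (θ s) = Real.exp (lft e * L s) * Real.exp (rgt e * R s) := by
      rw [← Real.exp_log (monomial_pos e (hθ s)), log_monomial e (hθ s), ← Real.exp_add]
      congr 1
      simp only [dotProduct, Fin.sum_univ_two, θ, Matrix.cons_val_zero, Matrix.cons_val_one,
        Matrix.cons_val_fin_one, Real.log_exp, lft, rgt]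
      field_simp
      ring
    rw [h3]
    simp only [L, R, sc] at h1 h2 ⊢
    rw [h1, h2]; ring
  have hcp : ∀ s ∈ Ioo (0 : ℝ) 1, α * monomial (p - r) (θ s) = s := by
    intro s hs
    have h1 : lft (p - r) = 1 := by
      simp only [lft, Pi.sub_apply]; rw [div_eq_one_iff_eq hD0]
    have h2 : rgt (p - r) = 0 := by
      simp only [rgt, Pi.sub_apply]; rw [div_eq_zero_iff]; left; rw [← hp0, ← hp1]; ring
    rw [hmon _ s hs]
    simp only [sc, h1, h2, Real.rpow_one, Real.rpow_zero, one_mul, zero_mul,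
      Real.exp_zero, mul_one, Real.exp_neg, Real.exp_log hα0]
    field_simp
  have hcq : ∀ s ∈ Ioo (0 : ℝ) 1, β * monomial (q - r) (θ s) = 1 - s := by
    intro s hs
    have h1 : lft (q - r) = 0 := by
      simp only [lft, Pi.sub_apply]; rw [div_eq_zero_iff]; left; rw [← hq0, ← hq1]; ring
    have h2 : rgt (q - r) = 1 := by
      simp only [rgt, Pi.sub_apply]; rw [div_eq_one_iff_eq hD0, ← hq0, ← hq1, hD]; ring
    rw [hmon _ s hs]
    simp only [sc, h1, h2, Real.rpow_one, Real.rpow_zero, one_mul, zero_mul,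
      Real.exp_zero, Real.exp_neg, Real.exp_log hβ0]
    field_simp
  refine ⟨⟨θ, lft, rgt, sc, fun e => mul_pos (Real.exp_pos _) (Real.exp_pos _), ?_,
    fun s _ => hθ s, ?_, ?_, ?_, ?_, hmon, ?_⟩⟩
  · intro e e' h1 h2
    simp only [lft, rgt] at h1 h2
    field_simp at h1 h2
    have e0 : D * (e 0 - e' 0) = 0 := by rw [hD]; linear_combination p0 * h1 + q0 * h2
    have e1 : D * (e 1 - e' 1) = 0 := by rw [hD]; linear_combination p1 * h1 + q1 * h2
    funext i
    fin_cases i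
    · exact sub_eq_zero.1 ((mul_eq_zero.1 e0).resolve_left hD0)
    · exact sub_eq_zero.1 ((mul_eq_zero.1 e1).resolve_left hD0)
  · intro s hs
    rw [hzero _ (hθ s), hcp s hs, hcq s hs]; ring
  · intro x hx h0
    rw [hzero x hx] at h0
    have hmp := monomial_pos (p - r) hx
    have hmq := monomial_pos (q - r) hx
    have h1 := mul_pos hα0 hmp
    have h2 := mul_pos hβ0 hmq
    refine ⟨α * monomial (p - r) x, ⟨h1, by linarith⟩, ?_⟩
    have hL : L (α * monomial (p - r) x) = p0 * Real.log (x 0) + p1 * Real.log (x 1) := by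
      simp only [L]
      rw [Real.log_mul hα0.ne' hmp.ne', log_monomial _ hx]
      simp [dotProduct, Fin.sum_univ_two, hp0, hp1]
    have hR : R (α * monomial (p - r) x) = q0 * Real.log (x 0) + q1 * Real.log (x 1) := by
      simp only [R]
      rw [show 1 - α * monomial (p - r) x = β * monomial (q - r) x by linarith,
        Real.log_mul hβ0.ne' hmq.ne', log_monomial _ hx]
      simp [dotProduct, Fin.sum_univ_two, hq0, hq1]
    funext i
    rw [← Real.exp_log (hx i)]
    fin_cases i
    · simp only [θ, Fin.zero_eta, Matrix.cons_val_zero, hL, hR]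
      congr 1
      rw [div_eq_iff hD0, hD]; ring
    · simp only [θ, Fin.mk_one, Matrix.cons_val_one, Matrix.cons_val_fin_one, hL, hR]
      congr 1
      rw [div_eq_iff hD0, hD]; ring
  · intro s hs t ht h
    rw [← hcp s hs, ← hcp t ht, h]
  · intro s hs
    have h0 : s ≠ 0 := hs.1.ne'
    have h1 : 1 - s ≠ 0 := (sub_pos.2 hs.2).ne'
    rw [differentiableAt_pi]
    intro i
    fin_cases i
    · simp only [θ, L, R, Fin.zero_eta, Matrix.cons_val_zero]
      fun_prop (disch := assumption)
    · simp only [θ, L, R, Fin.mk_one, Matrix.cons_val_one, Matrix.cons_val_fin_one]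
      fun_prop (disch := assumption)
  · intro x hx h0
    -- a direction in which `x ^ (p - r)` and `x ^ (q - r)` grow at the same rate
    refine ⟨fun i => x i * ![(q1 - p1) / D, (p0 - q0) / D] i, ?_⟩
    rw [fderiv_eval f hx]
    have e3 : ∀ φ : (Fin 2 → ℝ) → ℝ, ∑ e ∈ f.support, φ e = φ p + (φ q + φ r) := fun φ => by
      rw [hf, Finset.sum_insert (by simp [hpq, hpr]), Finset.sum_pair hqr]
    have h0' : f p * monomial p x + (f q * monomial q x + f r * monomial r x) = 0 := by
      rw [← e3 fun e => f e * monomial e x, ← eval_eq_sum]; exact h0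
    rw [e3]
    set w : Fin 2 → ℝ := ![(q1 - p1) / D, (p0 - q0) / D] with hw
    have hpw : p ⬝ᵥ w = 1 + r ⬝ᵥ w := by
      simp only [dotProduct, Fin.sum_univ_two, hw, Matrix.cons_val_zero, Matrix.cons_val_one,
        Matrix.cons_val_fin_one]
      field_simp
      rw [hD]
      linear_combination (q1 - p1) * (-hp0) + (p0 - q0) * (-hp1)
    have hqw : q ⬝ᵥ w = 1 + r ⬝ᵥ w := by
      simp only [dotProduct, Fin.sum_univ_two, hw, Matrix.cons_val_zero, Matrix.cons_val_one,
        Matrix.cons_val_fin_one]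
      field_simp
      rw [hD]
      linear_combination (q1 - p1) * (-hq0) + (p0 - q0) * (-hq1)
    rw [hpw, hqw]
    have : f p * monomial p x * (1 + r ⬝ᵥ w) + (f q * monomial q x * (1 + r ⬝ᵥ w) +
        f r * monomial r x * (r ⬝ᵥ w)) = -(f r * monomial r x) := by
      linear_combination (1 + r ⬝ᵥ w) * h0'
    rw [this]
    exact neg_ne_zero.2 (mul_ne_zero hr (monomial_pos r hx).ne')

namespace SegmentParametrization

variable {F : Fin 2 → Fewnomial 2}

/-- `g` along the curve. -/
noncomputable def pullback {f : Fewnomial 2} (P : SegmentParametrization f) (g : Fewnomial 2) :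
    ℝ → ℝ :=
  segmentSum g.support (fun e => C (g e * P.scale e)) P.left P.right

theorem eval_curve_eq {f : Fewnomial 2} (P : SegmentParametrization f) (g : Fewnomial 2) {s : ℝ}
    (hs : s ∈ Ioo (0 : ℝ) 1) : g.eval (P.curve s) = P.pullback g s := by
  rw [eval_eq_sum, pullback, segmentSum]
  refine Finset.sum_congr rfl fun e _ => ?_
  rw [P.monomial_curve e s hs, eval_C, mul_assoc]

theorem roots_eq (P : SegmentParametrization (F 0)) :
    roots F = P.curve '' {s ∈ Ioo (0 : ℝ) 1 | P.pullback (F 1) s = 0} := by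
  ext x
  constructor
  · rintro ⟨hx, h⟩
    obtain ⟨s, hs, rfl⟩ := P.surj x hx (h 0)
    exact ⟨s, ⟨hs, (P.eval_curve_eq _ hs).symm.trans (h 1)⟩, rfl⟩
  · rintro ⟨s, ⟨hs, h⟩, rfl⟩
    exact ⟨P.mem s hs, Fin.forall_fin_two.2 ⟨P.eval_curve s hs, (P.eval_curve_eq _ hs).trans h⟩⟩

theorem isolated_eq_empty (P : SegmentParametrization (F 0))
    (h : ∀ s ∈ Ioo (0 : ℝ) 1, P.pullback (F 1) s = 0) : {z | IsIsolatedRoot F z} = ∅ := by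
  refine eq_empty_of_forall_notMem fun z hz => ?_
  have hzr := hz.1
  rw [P.roots_eq] at hzr
  obtain ⟨s, ⟨hs, -⟩, rfl⟩ := hzr
  have hsub : Icc s ((s + 1) / 2) ⊆ Ioo 0 1 := fun t ht =>
    ⟨hs.1.trans_le ht.1, ht.2.trans_lt (by linarith [hs.2])⟩
  refine not_isIsolatedRoot_of_curve (by linarith [hs.2] : s < (s + 1) / 2)
    (fun t ht => (P.differentiableAt t (hsub ht)).continuousAt.continuousWithinAt)
    (P.injOn.mono hsub) (fun t ht => ?_) hz
  rw [P.roots_eq]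
  exact ⟨t, ⟨hsub ht, h t (hsub ht)⟩, rfl⟩

theorem encard_isolated_le (P : SegmentParametrization (F 0)) :
    {z | IsIsolatedRoot F z}.encard ≤ {s ∈ Ioo (0 : ℝ) 1 | P.pullback (F 1) s = 0}.encard := by
  refine (encard_le_encard fun z hz => hz.1).trans ?_
  rw [P.roots_eq]
  exact encard_image_le _ _

theorem zeros_pullback {f : Fewnomial 2} (P : SegmentParametrization f) (g : Fewnomial 2) :
    (∀ s ∈ Ioo (0 : ℝ) 1, P.pullback g s = 0) ∨
      {s ∈ Ioo (0 : ℝ) 1 | P.pullback g s = 0}.encard + 1 ≤ (2 ^ g.support.card - 1 : ℕ) := by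
  have := zeros_segmentSum g.support 0 (fun e => C (g e * P.scale e)) P.left P.right
    fun e _ => (natDegree_C _).le
  rw [zero_add, one_mul] at this
  exact this

theorem encard_isolated_le_two_pow (P : SegmentParametrization (F 0)) {m : ℕ}
    (hm : (F 1).support.card = m) : {z | IsIsolatedRoot F z}.encard ≤ (2 ^ m - 2 : ℕ) := by
  rcases P.zeros_pullback (F 1) with h | h
  · simp [P.isolated_eq_empty h]
  · have h1 : {z | IsIsolatedRoot F z}.encard + 1 ≤ (2 ^ m - 1 : ℕ) := by
      rw [← hm]; exact le_trans (by gcongr; exact P.encard_isolated_le) h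
    have h2 : 2 ^ m - 1 ≠ 0 := by
      intro h0
      rw [h0] at h1
      simp at h1
    have h3 : 2 ^ m - 1 = 2 ^ m - 2 + 1 := by omega
    rw [h3] at h1
    exact (ENat.add_le_add_iff_right (by simp)).1 (h1.trans_eq (by push_cast; rfl))

theorem encard_isolated_le_five (P : SegmentParametrization (F 0))
    (h3 : (F 1).support.card = 3) : {z | IsIsolatedRoot F z}.encard ≤ 5 := by
  rcases trinomial_sign_cases (F 1) h3 with h | ⟨p, q, r, hpq, hpr, hqr, hs, hp, hq⟩
  · have : {z | IsIsolatedRoot F z} = ∅ :=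
      eq_empty_of_forall_notMem fun z hz => h z hz.1.1 (hz.1.2 1)
    simp [this]
  have hr : F 1 r ≠ 0 := fun h => by simp [h] at hp
  set A := -(F 1 p * P.scale p) / (F 1 r * P.scale r) with hA
  set B := -(F 1 q * P.scale q) / (F 1 r * P.scale r) with hB
  have hsr := P.scale_pos r
  have hneg : ∀ e, F 1 e * F 1 r < 0 → 0 < -(F 1 e * P.scale e) / (F 1 r * P.scale r) := by
    intro e he
    have hse := P.scale_pos e
    have : -(F 1 e * P.scale e) / (F 1 r * P.scale r) =
        -(F 1 e * F 1 r) * P.scale e / (F 1 r ^ 2 * P.scale r) := by field_simp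
    rw [this]
    exact div_pos (mul_pos (neg_pos.2 he) hse) (by positivity)
  have hne : ∀ e, e ≠ r → ¬(P.left e - P.left r = 0 ∧ P.right e - P.right r = 0) := fun e he h =>
    he (P.ext_exponent e r (sub_eq_zero.1 h.1) (sub_eq_zero.1 h.2))
  have hfac : ∀ s ∈ Ioo (0 : ℝ) 1, P.pullback (F 1) s = 0 ↔
      segmentMonomial A (P.left p - P.left r) (P.right p - P.right r) s +
        segmentMonomial B (P.left q - P.left r) (P.right q - P.right r) s - 1 = 0 := by
    intro s hs'
    have h1 := (Real.rpow_pos_of_pos hs'.1 (P.left r)).ne'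
    have h2 := (Real.rpow_pos_of_pos (sub_pos.2 hs'.2) (P.right r)).ne'
    rw [pullback, segmentSum_eq_mul _ _ _ _ (P.left r) (P.right r) hs', mul_eq_zero,
      or_iff_right (mul_ne_zero h1 h2), segmentSum, hs, Finset.sum_insert (by simp [hpq, hpr]),
      Finset.sum_pair hqr]
    simp only [sub_self, Real.rpow_zero, mul_one, eval_C, segmentMonomial, hA, hB]
    have := hsr.ne'
    field_simp
    constructor <;> intro h <;> linarith
  rcases encard_add_le_five (hneg p hp) (hneg q hq) (hne p hpr) (hne q hqr) with h | h
  · simp [P.isolated_eq_empty fun s hs => (hfac s hs).2 (h s hs)]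
  · refine P.encard_isolated_le.trans (le_trans (encard_le_encard fun s hs => ?_) h)
    exact ⟨hs.1, (hfac s hs.1).1 hs.2⟩

/-- If the second equation does not vanish on the whole curve, all roots are isolated. -/
theorem isolated_eq_roots (P : SegmentParametrization (F 0)) {x : Fin 2 → ℝ}
    (hx : x ∈ positiveOrthant 2) (h0 : (F 0).eval x = 0) (h1 : (F 1).eval x ≠ 0) :
    {z | IsIsolatedRoot F z} = roots F := by
  have hfin : (roots F).Finite := by
    rw [P.roots_eq]
    refine Finite.image _ ?_
    rcases P.zeros_pullback (F 1) with h | h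
    · obtain ⟨s, hs, rfl⟩ := P.surj x hx h0
      exact absurd ((P.eval_curve_eq _ hs).trans (h s hs)) h1
    · exact finite_of_encard_le_coe (le_self_add.trans h)
  exact Subset.antisymm (fun z hz => hz.1) fun z hz => isIsolatedRoot_of_finite hfin hz

end SegmentParametrization

/-! ### Making roots non-degenerate -/

/-- Near each of its isolated zeros, a continuous function takes one of the values `±ε`
on the left, and one on the right. -/
theorem eventually_two_mul_encard_le {f : ℝ → ℝ} (hf : ContinuousOn f (Ioo 0 1))
    (hfin : {s ∈ Ioo (0 : ℝ) 1 | f s = 0}.Finite) :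
    ∀ᶠ ε in 𝓝[>] (0 : ℝ), 2 * {s ∈ Ioo (0 : ℝ) 1 | f s = 0}.encard ≤
      {s ∈ Ioo (0 : ℝ) 1 | f s = ε}.encard + {s ∈ Ioo (0 : ℝ) 1 | f s = -ε}.encard := by
  set Z := {s ∈ Ioo (0 : ℝ) 1 | f s = 0} with hZ
  have hr : ∀ᶠ ρ in 𝓝[>] (0 : ℝ), 0 < ρ ∧ (∀ z ∈ Z, 0 < z - ρ ∧ z + ρ < 1) ∧
      ∀ z ∈ Z, ∀ z' ∈ Z, z ≠ z' → 2 * ρ < |z - z'| := by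
    have hlt : ∀ {c : ℝ}, 0 < c → ∀ᶠ ρ in 𝓝[>] (0 : ℝ), ρ < c := fun hc =>
      (eventually_lt_nhds hc).filter_mono nhdsWithin_le_nhds
    refine (eventually_mem_nhdsWithin).and (((eventually_all_finite hfin).2 fun z hz => ?_).and
      ((eventually_all_finite hfin).2 fun z hz => (eventually_all_finite hfin).2 fun z' hz' => ?_))
    · filter_upwards [hlt hz.1.1, hlt (sub_pos.2 hz.1.2)] with ρ h1 h2
      exact ⟨by linarith, by linarith⟩
    · by_cases hne : z = z'
      · exact .of_forall fun _ h => absurd hne h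
      · filter_upwards [hlt (half_pos (abs_pos.2 (sub_ne_zero.2 hne)))] with ρ h1 _
        linarith
  obtain ⟨ρ, hρ, hin, hsep⟩ := hr.exists
  have hnz : ∀ z ∈ Z, ∀ y, |y - z| = ρ → y ∈ Ioo (0 : ℝ) 1 → f y ≠ 0 := by
    intro z hz y hy hy1 h0
    have hne : y ≠ z := by rintro rfl; simp at hy; exact hρ.ne hy
    have := hsep y ⟨hy1, h0⟩ z hz hne
    linarith
  have hmemL : ∀ z ∈ Z, z - ρ ∈ Ioo (0 : ℝ) 1 := fun z hz =>
    ⟨(hin z hz).1, by linarith [hz.1.2]⟩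
  have hmemR : ∀ z ∈ Z, z + ρ ∈ Ioo (0 : ℝ) 1 := fun z hz =>
    ⟨by linarith [hz.1.1], (hin z hz).2⟩
  have hε : ∀ᶠ ε in 𝓝[>] (0 : ℝ), 0 < ε ∧ ∀ z ∈ Z, ε < |f (z - ρ)| ∧ ε < |f (z + ρ)| := by
    refine eventually_mem_nhdsWithin.and ((eventually_all_finite hfin).2 fun z hz => ?_)
    have h1 : 0 < |f (z - ρ)| := abs_pos.2 (hnz z hz _ (by simp [abs_of_pos hρ]) (hmemL z hz))
    have h2 : 0 < |f (z + ρ)| := abs_pos.2 (hnz z hz _ (by simp [abs_of_pos hρ]) (hmemR z hz))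
    exact ((eventually_lt_nhds h1).filter_mono nhdsWithin_le_nhds).and
      ((eventually_lt_nhds h2).filter_mono nhdsWithin_le_nhds)
  filter_upwards [hε] with ε hε
  obtain ⟨hε0, hε⟩ := hε
  have hL : ∀ z ∈ Z, ∃ s ∈ Ioo (z - ρ) z, |f s| = ε := by
    intro z hz
    have hc : ContinuousOn (fun s => |f s|) (Icc (z - ρ) z) := (hf.mono fun s hs =>
      ⟨(hmemL z hz).1.trans_le hs.1, hs.2.trans_lt hz.1.2⟩).abs
    have := intermediate_value_Ioo' (by linarith) hc
    simp only [hz.2, abs_zero] at this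
    exact this ⟨hε0, (hε z hz).1⟩
  have hR : ∀ z ∈ Z, ∃ s ∈ Ioo z (z + ρ), |f s| = ε := by
    intro z hz
    have hc : ContinuousOn (fun s => |f s|) (Icc z (z + ρ)) := (hf.mono fun s hs =>
      ⟨hz.1.1.trans_le hs.1, hs.2.trans_lt (hmemR z hz).2⟩).abs
    have := intermediate_value_Ioo (by linarith) hc
    simp only [hz.2, abs_zero] at this
    exact this ⟨hε0, (hε z hz).2⟩
  choose! l hl hlε using hL
  choose! r hr hrε using hR
  have hsep' : ∀ z ∈ Z, ∀ z' ∈ Z, ∀ y, |y - z| < ρ → |y - z'| < ρ → z = z' := by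
    intro z hz z' hz' y h1 h2
    by_contra hne
    have h3 := hsep z hz z' hz' hne
    have h4 := abs_sub_le z y z'
    rw [abs_sub_comm z y] at h4
    linarith
  have hlz : ∀ z ∈ Z, |l z - z| < ρ := fun z hz => by
    rw [abs_lt]; constructor <;> linarith [(hl z hz).1, (hl z hz).2]
  have hrz : ∀ z ∈ Z, |r z - z| < ρ := fun z hz => by
    rw [abs_lt]; constructor <;> linarith [(hr z hz).1, (hr z hz).2]
  have hli : InjOn l Z := fun z hz z' hz' h =>
    hsep' z hz z' hz' (l z) (hlz z hz) (by rw [h]; exact hlz z' hz')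
  have hri : InjOn r Z := fun z hz z' hz' h =>
    hsep' z hz z' hz' (r z) (hrz z hz) (by rw [h]; exact hrz z' hz')
  have hdisj : Disjoint (l '' Z) (r '' Z) := by
    rw [Set.disjoint_left]
    rintro _ ⟨z, hz, rfl⟩ ⟨z', hz', h⟩
    obtain rfl := hsep' z hz z' hz' (l z) (hlz z hz) (by rw [← h]; exact hrz z' hz')
    exact lt_asymm (hl z hz).2 (h ▸ (hr z hz).1)
  have hsub : l '' Z ∪ r '' Z ⊆ {s ∈ Ioo (0 : ℝ) 1 | f s = ε} ∪ {s ∈ Ioo (0 : ℝ) 1 | f s = -ε} := by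
    have key : ∀ y, y ∈ Ioo (0 : ℝ) 1 → |f y| = ε →
        y ∈ {s ∈ Ioo (0 : ℝ) 1 | f s = ε} ∪ {s ∈ Ioo (0 : ℝ) 1 | f s = -ε} := by
      intro y hy h
      rcases (abs_eq hε0.le).1 h with h | h
      · exact .inl ⟨hy, h⟩
      · exact .inr ⟨hy, h⟩
    rintro _ (⟨z, hz, rfl⟩ | ⟨z, hz, rfl⟩)
    · exact key _ ⟨(hmemL z hz).1.trans (hl z hz).1, (hl z hz).2.trans hz.1.2⟩ (hlε z hz)
    · exact key _ ⟨hz.1.1.trans (hr z hz).1, (hr z hz).2.trans (hmemR z hz).2⟩ (hrε z hz)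
  calc 2 * Z.encard = (l '' Z).encard + (r '' Z).encard := by
        rw [hli.encard_image, hri.encard_image, two_mul]
    _ = (l '' Z ∪ r '' Z).encard := (encard_union_eq hdisj).symm
    _ ≤ _ := (encard_le_encard hsub).trans (encard_union_le _ _)

theorem eval_update {n : ℕ} (f : Fewnomial n) {e : Fin n → ℝ} (he : e ∈ f.support) {b : ℝ}
    (hb : b ≠ 0) (x : Fin n → ℝ) :
    eval (f.update e b) x = f.eval x + (b - f e) * monomial e x := by
  classical
  rw [eval_eq_sum, eval_eq_sum, Finsupp.support_update_ne_zero f e hb, Finset.insert_eq_of_mem he,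
    ← Finset.add_sum_erase _ _ he, ← Finset.add_sum_erase _ (fun e => f e * monomial e x) he]
  have : ∑ y ∈ f.support.erase e, (f.update e b) y * monomial y x =
      ∑ y ∈ f.support.erase e, f y * monomial y x :=
    Finset.sum_congr rfl fun y hy => by
      rw [Finsupp.coe_update, Function.update_of_ne (Finset.ne_of_mem_erase hy)]
  rw [this, Finsupp.coe_update, Function.update_self]
  ring

theorem card_support_update {n : ℕ} (f : Fewnomial n) {e : Fin n → ℝ} (he : e ∈ f.support) {b : ℝ}
    (hb : b ≠ 0) : (f.update e b).support.card = f.support.card := by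
  classical
  rw [Finsupp.support_update_ne_zero f e hb, Finset.insert_eq_of_mem he]

namespace SegmentParametrization

variable {F : Fin 2 → Fewnomial 2}

/-- Changing the coefficient of `x ^ e` by `-c` turns the points where the quotient by `x ^ e` takes
the value `c` into roots, which are non-degenerate if `c` is a regular value. -/
theorem encard_level_le_maxNondegenerate (P : SegmentParametrization (F 0)) {m : ℕ}
    (hF : IsOfType F ![3, m]) {e : Fin 2 → ℝ} (he : e ∈ (F 1).support) {h' : ℝ → ℝ}
    (hd : ∀ s ∈ Ioo (0 : ℝ) 1,
      HasDerivAt (fun s => (F 1).eval (P.curve s) / monomial e (P.curve s)) (h' s) s)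
    {c : ℝ} (hc : F 1 e - c ≠ 0)
    (hreg : ∀ s ∈ Ioo (0 : ℝ) 1, h' s = 0 →
      (F 1).eval (P.curve s) / monomial e (P.curve s) ≠ c) :
    {s ∈ Ioo (0 : ℝ) 1 | (F 1).eval (P.curve s) / monomial e (P.curve s) = c}.encard ≤
      maxNondegenerate ![3, m] := by
  set G : Fin 2 → Fewnomial 2 := ![F 0, (F 1).update e (F 1 e - c)] with hG
  have hG1 : ∀ x, (G 1).eval x = (F 1).eval x - c * monomial e x := fun x => by
    have := eval_update (F 1) he hc x
    simp only [hG, Matrix.cons_val_one, Matrix.cons_val_fin_one, this]; ring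
  have htype : IsOfType G ![3, m] := by
    refine Fin.forall_fin_two.2 ⟨hF 0, (hF 1).1, ?_⟩
    exact (card_support_update (F 1) he hc).trans (hF 1).2
  refine le_trans ?_ (le_iSup₂_of_le G htype le_rfl)
  rw [← (P.injOn.mono fun s hs => hs.1 : InjOn P.curve
    {s ∈ Ioo (0 : ℝ) 1 | (F 1).eval (P.curve s) / monomial e (P.curve s) = c}).encard_image]
  refine encard_le_encard ?_
  rintro _ ⟨s, ⟨hs, hsc⟩, rfl⟩
  have hx := P.mem s hs
  have hpos := monomial_pos e hx
  have hroot : P.curve s ∈ roots G := by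
    refine ⟨hx, Fin.forall_fin_two.2 ⟨P.eval_curve s hs, ?_⟩⟩
    rw [hG1, ← hsc]; field_simp; simp
  obtain ⟨v, hv⟩ := P.regular _ hx (P.eval_curve s hs)
  have hcurve := (P.differentiableAt s hs).hasDerivAt
  refine isNondegenerateRoot_of_fderiv (v := v) (w := deriv P.curve s) hroot hv ?_ ?_
  · have h1 := (differentiableAt_eval (F 0) hx).hasFDerivAt.comp_hasDerivAt s hcurve
    have h2 : (F 0).eval ∘ P.curve =ᶠ[𝓝 s] fun _ => 0 := by
      filter_upwards [Ioo_mem_nhds hs.1 hs.2] with t ht using P.eval_curve t ht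
    exact h1.unique ((hasDerivAt_const s (0 : ℝ)).congr_of_eventuallyEq h2)
  · have h1 := (differentiableAt_eval (G 1) hx).hasFDerivAt.comp_hasDerivAt s hcurve
    -- `G₁ = x ^ e (h - c)` along the curve, and `h - c` vanishes at `s`
    have hmd : DifferentiableAt ℝ (fun t => monomial e (P.curve t)) s := by
      have h0 : s ≠ 0 := hs.1.ne'
      have h1 : 1 - s ≠ 0 := (sub_pos.2 hs.2).ne'
      have h2 : (fun t => monomial e (P.curve t)) =ᶠ[𝓝 s]
          fun t => P.scale e * (t ^ P.left e * (1 - t) ^ P.right e) := by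
        filter_upwards [Ioo_mem_nhds hs.1 hs.2] with t ht using P.monomial_curve e t ht
      refine DifferentiableAt.congr_of_eventuallyEq ?_ h2
      fun_prop (disch := simp [h0, h1])
    have h2 := hmd.hasDerivAt.mul ((hd s hs).sub_const c)
    have h3 : (G 1).eval ∘ P.curve =ᶠ[𝓝 s] fun t => monomial e (P.curve t) *
        ((F 1).eval (P.curve t) / monomial e (P.curve t) - c) := by
      filter_upwards [Ioo_mem_nhds hs.1 hs.2] with t ht
      have := (monomial_pos e (P.mem t ht)).ne'
      simp only [Function.comp, hG1]
      field_simp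
    rw [h1.unique (h2.congr_of_eventuallyEq h3), hsc, sub_self, mul_zero, zero_add]
    exact mul_ne_zero hpos.ne' fun h0 => hreg s hs h0 hsc

theorem encard_isolated_le_maxNondegenerate (P : SegmentParametrization (F 0)) {m : ℕ}
    (hF : IsOfType F ![3, m]) : {z | IsIsolatedRoot F z}.encard ≤ maxNondegenerate ![3, m] := by
  have hm : (F 1).support.card = m := (hF 1).2
  have hm1 : 1 ≤ m := (hF 1).1
  rcases P.zeros_pullback (F 1) with hall | hfin
  · simp [P.isolated_eq_empty hall]
  refine P.encard_isolated_le.trans ?_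
  obtain ⟨e, he⟩ : (F 1).support.Nonempty := Finset.card_pos.1 (by omega)
  set h : ℝ → ℝ := fun s => (F 1).eval (P.curve s) / monomial e (P.curve s) with hh
  set a : (Fin 2 → ℝ) → ℝ := fun i => P.left i - P.left e
  set b : (Fin 2 → ℝ) → ℝ := fun i => P.right i - P.right e
  set c : (Fin 2 → ℝ) → ℝ[X] := fun i => C (F 1 i * P.scale i)
  set H : ℝ → ℝ := segmentSum (F 1).support (fun i => segmentDeriv (c i) (a i) (b i))
    (fun i => a i - 1) (fun i => b i - 1) with hH
  have hse := (P.scale_pos e).ne'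
  have hseg : ∀ s ∈ Ioo (0 : ℝ) 1, h s = segmentSum (F 1).support c a b s / P.scale e := by
    intro s hs
    have h1 := (Real.rpow_pos_of_pos hs.1 (P.left e)).ne'
    have h2 := (Real.rpow_pos_of_pos (sub_pos.2 hs.2) (P.right e)).ne'
    simp only [hh]
    rw [P.eval_curve_eq _ hs, P.monomial_curve e s hs, pullback,
      segmentSum_eq_mul _ _ _ _ (P.left e) (P.right e) hs]
    field_simp
    rfl
  have hd : ∀ s ∈ Ioo (0 : ℝ) 1, HasDerivAt h (H s / P.scale e) s := fun s hs =>
    ((hasDerivAt_segmentSum (F 1).support c a b hs).div_const _).congr_of_eventuallyEq (by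
      filter_upwards [Ioo_mem_nhds hs.1 hs.2] with t ht using hseg t ht)
  have hz : {s ∈ Ioo (0 : ℝ) 1 | P.pullback (F 1) s = 0} = {s ∈ Ioo (0 : ℝ) 1 | h s = 0} := by
    ext s
    refine and_congr_right fun hs => ?_
    rw [← P.eval_curve_eq _ hs, div_eq_zero_iff, or_iff_left (monomial_pos e (P.mem s hs)).ne']
  have hfin' : {s ∈ Ioo (0 : ℝ) 1 | h s = 0}.Finite := by
    rw [← hz]; exact finite_of_encard_le_coe (le_self_add.trans hfin)
  rw [hz]
  rcases zeros_segmentSum (F 1).support 1 (fun i => segmentDeriv (c i) (a i) (b i))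
    (fun i => a i - 1) (fun i => b i - 1)
    (fun i _ => natDegree_segmentDeriv_le (natDegree_C _).le _ _) with hH0 | hHfin
  · -- a constant with finitely many zeros on `(0, 1)` has none
    have : {s ∈ Ioo (0 : ℝ) 1 | h s = 0} = ∅ := by
      by_contra hne
      obtain ⟨s, hs, hs0⟩ := nonempty_iff_ne_empty.2 hne
      refine (Ioo_infinite (zero_lt_one' ℝ)) (hfin'.subset fun t ht => ⟨ht, ?_⟩)
      rw [← hs0]
      exact eq_const_of_hasDerivAt_zero ordConnected_Ioo hd
        (fun y hy => div_eq_zero_iff.2 (.inl (hH0 y hy))) ht hs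
    rw [this]; simp
  · have hcrit : (h '' {s ∈ Ioo (0 : ℝ) 1 | H s = 0}).Finite :=
      (finite_of_encard_le_coe (le_self_add.trans hHfin)).image _
    have hne : F 1 e ≠ 0 := Finsupp.mem_support_iff.1 he
    have hbad : (h '' {s ∈ Ioo (0 : ℝ) 1 | H s = 0} ∪ {F 1 e}).Finite :=
      hcrit.union (finite_singleton _)
    -- small values other than zero avoid a given finite set
    have hgood : ∀ᶠ ε in 𝓝[≠] (0 : ℝ), ε ∉ h '' {s ∈ Ioo (0 : ℝ) 1 | H s = 0} ∪ {F 1 e} := by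
      have := (hbad.subset (sdiff_subset (t := {0}))).isClosed.isOpen_compl.mem_nhds
        (show (0 : ℝ) ∈ _ by simp)
      rw [eventually_nhdsWithin_iff]
      filter_upwards [this] with x hx hx0 hxb using hx ⟨hxb, hx0⟩
    have hgood1 : ∀ᶠ ε in 𝓝[>] (0 : ℝ), ε ∉ h '' {s ∈ Ioo (0 : ℝ) 1 | H s = 0} ∪ {F 1 e} :=
      hgood.filter_mono (nhdsWithin_mono _ fun x hx => ne_of_gt hx)
    have hgood2 : ∀ᶠ ε in 𝓝[>] (0 : ℝ), -ε ∉ h '' {s ∈ Ioo (0 : ℝ) 1 | H s = 0} ∪ {F 1 e} := by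
      have ht : Tendsto (fun ε : ℝ => -ε) (𝓝[>] 0) (𝓝[≠] 0) := by
        refine tendsto_nhdsWithin_iff.2 ⟨?_, ?_⟩
        · have : Tendsto (fun ε : ℝ => -ε) (𝓝 0) (𝓝 (-0)) := continuous_neg.tendsto 0
          rw [neg_zero] at this
          exact this.mono_left nhdsWithin_le_nhds
        · filter_upwards [self_mem_nhdsWithin] with ε hε
          exact neg_ne_zero.2 (ne_of_gt hε)
      exact ht.eventually hgood
    have hcont : ContinuousOn h (Ioo 0 1) := fun s hs => (hd s hs).continuousAt.continuousWithinAt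
    obtain ⟨ε, h1, h2, h3⟩ :=
      ((eventually_two_mul_encard_le hcont hfin').and (hgood1.and hgood2)).exists
    have hlevel : ∀ c, c ∉ h '' {s ∈ Ioo (0 : ℝ) 1 | H s = 0} ∪ {F 1 e} →
        {s ∈ Ioo (0 : ℝ) 1 | h s = c}.encard ≤ maxNondegenerate ![3, m] := fun c hc =>
      P.encard_level_le_maxNondegenerate hF he hd
        (sub_ne_zero.2 fun h => hc (.inr h.symm)) fun s hs h0 hsc =>
          hc (.inl ⟨s, ⟨hs, (div_eq_zero_iff.1 h0).resolve_right hse⟩, hsc⟩)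
    by_contra! hlt
    have h4 := (hlevel ε h2).trans_lt hlt
    have h5 := (hlevel (-ε) h3).trans_lt hlt
    have h6 := ENat.add_lt_add h4 h5
    rw [← two_mul] at h6
    exact absurd h1 (not_le.2 h6)

end SegmentParametrization

/-- A system whose first member is a trinomial has few isolated roots for a simple reason, or its
first member defines a regular curve parametrized by a segment. -/
theorem isolated_cases {F : Fin 2 → Fewnomial 2} {m : ℕ} (hF : IsOfType F ![3, m]) :
    {z | IsIsolatedRoot F z}.encard ≤ (2 * (m - 1) : ℕ) ∨
      Nonempty (SegmentParametrization (F 0)) := by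
  have hm : (F 1).support.card = m := (hF 1).2
  have hm1 : 1 ≤ m := (hF 1).1
  rcases trinomial_sign_cases (F 0) (hF 0).2 with h | ⟨p, q, r, hpq, hpr, hqr, hs, hp, hq⟩
  · left
    have : {z | IsIsolatedRoot F z} = ∅ :=
      eq_empty_of_forall_notMem fun z hz => h z hz.1.1 (hz.1.2 0)
    simp [this]
  by_cases hdet : (p 0 - r 0) * (q 1 - r 1) = (p 1 - r 1) * (q 0 - r 0)
  · exact .inl (encard_isolated_le_of_collinear hpq hpr hqr hs (by omega) hdet)
  · exact .inr (nonempty_segmentParametrization hpq hpr hqr hs hp hq hdet)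

theorem maxIsolated_le_two_pow {m : ℕ} (hm : 3 ≤ m) :
    maxIsolated ![3, m] ≤ (2 ^ m - 2 : ℕ) := by
  refine iSup₂_le fun F hF => ?_
  rcases isolated_cases hF with h | ⟨⟨P⟩⟩
  · refine h.trans ?_
    have h1 : m - 1 < 2 ^ (m - 1) := Nat.lt_two_pow_self
    have h2 : 2 ^ m = 2 * 2 ^ (m - 1) := by rw [← pow_succ']; congr 1; omega
    exact_mod_cast (by omega : 2 * (m - 1) ≤ 2 ^ m - 2)
  · exact P.encard_isolated_le_two_pow (hF 1).2

theorem maxIsolated_three_three_le : maxIsolated ![3, 3] ≤ 5 := by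
  refine iSup₂_le fun F hF => ?_
  rcases isolated_cases hF with h | ⟨⟨P⟩⟩
  · exact h.trans (by norm_num)
  · exact P.encard_isolated_le_five (hF 1).2

theorem maxIsolated_le_maxNondegenerate {m : ℕ} (hm : 1 ≤ m) :
    maxIsolated ![3, m] ≤ maxNondegenerate ![3, m] := by
  refine iSup₂_le fun F hF => ?_
  rcases isolated_cases hF with h | ⟨⟨P⟩⟩
  · have := two_mul_le_maxNondegenerate (m - 1)
    rw [Nat.sub_add_cancel hm] at this
    exact h.trans this
  · exact P.encard_isolated_le_maxNondegenerate hF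

/-! ### Two trinomials with five common zeros -/

/-- The trinomial `A x ^ p + B x ^ q + D x ^ r`. -/
noncomputable def trinomial {n : ℕ} (A B D : ℝ) (p q r : Fin n → ℝ) : Fewnomial n :=
  Finsupp.single p A + Finsupp.single q B + Finsupp.single r D

theorem support_trinomial {n : ℕ} {A B D : ℝ} {p q r : Fin n → ℝ} (hpq : p ≠ q) (hpr : p ≠ r)
    (hqr : q ≠ r) (hA : A ≠ 0) (hB : B ≠ 0) (hD : D ≠ 0) :
    (trinomial A B D p q r).support = {p, q, r} := by
  ext e
  simp only [trinomial, Finsupp.mem_support_iff, Finsupp.add_apply, Finset.mem_insert,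
    Finset.mem_singleton]
  by_cases h1 : e = p
  · subst h1; simp [hpq, hpr, hA]
  by_cases h2 : e = q
  · subst h2; simp [hpq, hqr, hB]
  by_cases h3 : e = r
  · subst h3; simp [hpr, hqr, hD]
  · simp [h1, h2, h3]

theorem card_support_trinomial {n : ℕ} {A B D : ℝ} {p q r : Fin n → ℝ} (hpq : p ≠ q) (hpr : p ≠ r)
    (hqr : q ≠ r) (hA : A ≠ 0) (hB : B ≠ 0) (hD : D ≠ 0) :
    (trinomial A B D p q r).support.card = 3 := by
  rw [support_trinomial hpq hpr hqr hA hB hD]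
  exact Finset.card_eq_three.2 ⟨p, q, r, hpq, hpr, hqr, rfl⟩

theorem eval_trinomial_eq {n : ℕ} {A B D : ℝ} {p q r : Fin n → ℝ} (hpq : p ≠ q) (hpr : p ≠ r)
    (hqr : q ≠ r) (hA : A ≠ 0) (hB : B ≠ 0) (hD : D ≠ 0) (x : Fin n → ℝ) :
    (trinomial A B D p q r).eval x = A * monomial p x + B * monomial q x + D * monomial r x := by
  rw [eval_eq_sum, support_trinomial hpq hpr hqr hA hB hD, Finset.sum_insert (by simp [hpq, hpr]),
    Finset.sum_pair hqr]
  simp [trinomial, hpq, hpr, hqr, hpq.symm, hpr.symm, hqr.symm]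
  ring

/-- The system `x ^ 12 + y ^ 2 - 1`, `2 / 5 y ^ 30 + 41 / 25 x ^ 4 y - x`. On the curve
`y = √(1 - x ^ 12)` the second member changes sign between any two consecutive ones of the points
`x = 0.3, 0.55, 0.7, 0.83, 0.9, 0.95`. The exponents are chosen such that its extrema there are not
too small, so that coarse rational bounds on the square root determine the signs. -/
noncomputable def fiveRootSystem : Fin 2 → Fewnomial 2 :=
  ![trinomial 1 1 (-1) ![12, 0] ![0, 2] ![0, 0],
    trinomial (2 / 5) (41 / 25) (-1) ![0, 30] ![4, 1] ![1, 0]]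

theorem vec_ne_of_fst {a b c d : ℝ} (h : a ≠ c) : ![a, b] ≠ ![c, d] := fun h' => h (congrFun h' 0)

theorem vec_ne_of_snd {a b c d : ℝ} (h : b ≠ d) : ![a, b] ≠ ![c, d] := fun h' => h (congrFun h' 1)

theorem isOfType_fiveRootSystem : IsOfType fiveRootSystem ![3, 3] := by
  refine Fin.forall_fin_two.2 ⟨⟨by simp, ?_⟩, ⟨by simp, ?_⟩⟩
  · exact card_support_trinomial (vec_ne_of_fst (by norm_num)) (vec_ne_of_fst (by norm_num))
      (vec_ne_of_snd (by norm_num)) (by norm_num) (by norm_num) (by norm_num)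
  · exact card_support_trinomial (vec_ne_of_fst (by norm_num)) (vec_ne_of_fst (by norm_num))
      (vec_ne_of_fst (by norm_num)) (by norm_num) (by norm_num) (by norm_num)

theorem eval_fiveRootSystem_zero (x y : ℝ) :
    (fiveRootSystem 0).eval ![x, y] = x ^ 12 + y ^ 2 - 1 := by
  rw [fiveRootSystem, Matrix.cons_val_zero, eval_trinomial_eq (vec_ne_of_fst (by norm_num))
    (vec_ne_of_fst (by norm_num)) (vec_ne_of_snd (by norm_num)) (by norm_num) (by norm_num)
    (by norm_num)]
  simp only [monomial, Fin.prod_univ_two, Matrix.cons_val_zero, Matrix.cons_val_one,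
    Matrix.cons_val_fin_one, Real.rpow_zero, Real.rpow_ofNat]
  ring

theorem eval_fiveRootSystem_one (x y : ℝ) :
    (fiveRootSystem 1).eval ![x, y] = 2 / 5 * y ^ 30 + 41 / 25 * (x ^ 4 * y) - x := by
  rw [fiveRootSystem, Matrix.cons_val_one, Matrix.cons_val_fin_one,
    eval_trinomial_eq (vec_ne_of_fst (by norm_num)) (vec_ne_of_fst (by norm_num))
    (vec_ne_of_fst (by norm_num)) (by norm_num) (by norm_num) (by norm_num)]
  simp only [monomial, Fin.prod_univ_two, Matrix.cons_val_zero, Matrix.cons_val_one,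
    Matrix.cons_val_fin_one, Real.rpow_zero, Real.rpow_ofNat, Real.rpow_one]
  ring

/-- The second member of `fiveRootSystem` along the zero set of the first. -/
noncomputable def fiveRootFunction (x : ℝ) : ℝ :=
  2 / 5 * (1 - x ^ 12) ^ 15 + 41 / 25 * (x ^ 4 * √(1 - x ^ 12)) - x

theorem fiveRootFunction_pos {x l : ℝ} (h : l ^ 2 ≤ 1 - x ^ 12)
    (h' : 0 < 2 / 5 * (1 - x ^ 12) ^ 15 + 41 / 25 * (x ^ 4 * l) - x) : 0 < fiveRootFunction x := by
  have h1 : l ≤ √(1 - x ^ 12) := Real.le_sqrt_of_sq_le h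
  have h2 : x ^ 4 * l ≤ x ^ 4 * √(1 - x ^ 12) := mul_le_mul_of_nonneg_left h1 (by positivity)
  unfold fiveRootFunction
  linarith

theorem fiveRootFunction_neg {x u : ℝ} (hu : 0 ≤ u) (h : 1 - x ^ 12 ≤ u ^ 2)
    (h' : 2 / 5 * (1 - x ^ 12) ^ 15 + 41 / 25 * (x ^ 4 * u) - x < 0) : fiveRootFunction x < 0 := by
  have h1 : √(1 - x ^ 12) ≤ u := Real.sqrt_le_iff.2 ⟨hu, h⟩
  have h2 : x ^ 4 * √(1 - x ^ 12) ≤ x ^ 4 * u := mul_le_mul_of_nonneg_left h1 (by positivity)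
  unfold fiveRootFunction
  linarith

theorem continuous_fiveRootFunction : Continuous fiveRootFunction := by
  unfold fiveRootFunction; fun_prop

/-- The point of the zero set of `fiveRootSystem 0` over `x`. -/
noncomputable def fiveRootCurve (x : ℝ) : Fin 2 → ℝ := ![x, √(1 - x ^ 12)]

theorem fiveRootCurve_spec {x : ℝ} (hx : x ∈ Ioo (0 : ℝ) 1) :
    fiveRootCurve x ∈ positiveOrthant 2 ∧ (fiveRootSystem 0).eval (fiveRootCurve x) = 0 ∧
      (fiveRootSystem 1).eval (fiveRootCurve x) = fiveRootFunction x := by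
  have h1 : 0 < 1 - x ^ 12 := sub_pos.2 (pow_lt_one₀ hx.1.le hx.2 (by norm_num))
  have h2 := Real.sq_sqrt h1.le
  refine ⟨Fin.forall_fin_two.2 ⟨hx.1, Real.sqrt_pos.2 h1⟩, ?_, ?_⟩
  · rw [fiveRootCurve, eval_fiveRootSystem_zero, h2]; ring
  · rw [fiveRootCurve, eval_fiveRootSystem_one, fiveRootFunction,
      show (30 : ℕ) = 2 * 15 by norm_num, pow_mul, h2]

theorem five_le_maxIsolated : 5 ≤ maxIsolated ![3, 3] := by
  have s0 : 0 < fiveRootFunction 0.3 := fiveRootFunction_pos (l := 0.99) (by norm_num)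
    (by norm_num)
  have s1 : fiveRootFunction 0.55 < 0 := fiveRootFunction_neg (u := 1) (by norm_num)
    (by norm_num) (by norm_num)
  have s2 : 0 < fiveRootFunction 0.7 := fiveRootFunction_pos (l := 0.99) (by norm_num)
    (by norm_num)
  have s3 : fiveRootFunction 0.83 < 0 := fiveRootFunction_neg (u := 0.95) (by norm_num)
    (by norm_num) (by norm_num)
  have s4 : 0 < fiveRootFunction 0.9 := fiveRootFunction_pos (l := 0.845) (by norm_num)
    (by norm_num)
  have s5 : fiveRootFunction 0.95 < 0 := fiveRootFunction_neg (u := 0.68) (by norm_num)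
    (by norm_num) (by norm_num)
  have hc : ∀ s, ContinuousOn fiveRootFunction s := fun s => continuous_fiveRootFunction.continuousOn
  obtain ⟨x1, h1, z1⟩ := intermediate_value_Ioo' (by norm_num) (hc (Icc 0.3 0.55)) ⟨s1, s0⟩
  obtain ⟨x2, h2, z2⟩ := intermediate_value_Ioo (by norm_num) (hc (Icc 0.55 0.7)) ⟨s1, s2⟩
  obtain ⟨x3, h3, z3⟩ := intermediate_value_Ioo' (by norm_num) (hc (Icc 0.7 0.83)) ⟨s3, s2⟩
  obtain ⟨x4, h4, z4⟩ := intermediate_value_Ioo (by norm_num) (hc (Icc 0.83 0.9)) ⟨s3, s4⟩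
  obtain ⟨x5, h5, z5⟩ := intermediate_value_Ioo' (by norm_num) (hc (Icc 0.9 0.95)) ⟨s5, s4⟩
  have hmem : ∀ i, ![x1, x2, x3, x4, x5] i ∈ Ioo (0 : ℝ) 1 ∧
      fiveRootFunction (![x1, x2, x3, x4, x5] i) = 0 := by
    have key : ∀ {x l u : ℝ}, 0 ≤ l → u ≤ 1 → x ∈ Ioo l u → x ∈ Ioo (0 : ℝ) 1 :=
      fun hl hu hx => ⟨hl.trans_lt hx.1, hx.2.trans_le hu⟩
    intro i
    fin_cases i
    · exact ⟨key (by norm_num) (by norm_num) h1, z1⟩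
    · exact ⟨key (by norm_num) (by norm_num) h2, z2⟩
    · exact ⟨key (by norm_num) (by norm_num) h3, z3⟩
    · exact ⟨key (by norm_num) (by norm_num) h4, z4⟩
    · exact ⟨key (by norm_num) (by norm_num) h5, z5⟩
  have hmono : StrictMono ![x1, x2, x3, x4, x5] := by
    rw [Fin.strictMono_iff_lt_succ]
    intro i
    fin_cases i
    · exact h1.2.trans h2.1
    · exact h2.2.trans h3.1
    · exact h3.2.trans h4.1
    · exact h4.2.trans h5.1
  have hinj : Function.Injective fun i => fiveRootCurve (![x1, x2, x3, x4, x5] i) :=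
    fun i j h => hmono.injective (congrFun h 0)
  have hroots : range (fun i => fiveRootCurve (![x1, x2, x3, x4, x5] i)) ⊆
      {z | IsIsolatedRoot fiveRootSystem z} := by
    have hiso : {z | IsIsolatedRoot fiveRootSystem z} = roots fiveRootSystem := by
      obtain ⟨P⟩ : Nonempty (SegmentParametrization (fiveRootSystem 0)) := by
        have hpq : (![12, 0] : Fin 2 → ℝ) ≠ ![0, 2] := vec_ne_of_fst (by norm_num)
        have hpr : (![12, 0] : Fin 2 → ℝ) ≠ ![0, 0] := vec_ne_of_fst (by norm_num)
        have hqr : (![0, 2] : Fin 2 → ℝ) ≠ ![0, 0] := vec_ne_of_snd (by norm_num)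
        refine nonempty_segmentParametrization hpq hpr hqr
          (support_trinomial hpq hpr hqr one_ne_zero one_ne_zero (by norm_num)) ?_ ?_ ?_
        · simp [fiveRootSystem, trinomial, hpq, hpr, hpr.symm, hqr.symm]
        · simp [fiveRootSystem, trinomial, hqr, hpq.symm, hpr.symm, hqr.symm]
        · simp
      obtain ⟨m1, m2, m3⟩ := fiveRootCurve_spec (x := 0.3) ⟨by norm_num, by norm_num⟩
      exact P.isolated_eq_roots m1 m2 (by rw [m3]; exact s0.ne')
    rw [hiso]
    rintro _ ⟨i, rfl⟩
    obtain ⟨m1, m2, m3⟩ := fiveRootCurve_spec (hmem i).1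
    exact ⟨m1, Fin.forall_fin_two.2 ⟨m2, m3.trans (hmem i).2⟩⟩
  calc (5 : ℕ∞) = (range fun i => fiveRootCurve (![x1, x2, x3, x4, x5] i)).encard := by
        rw [← image_univ, hinj.encard_image, encard_univ]; simp
    _ ≤ _ := encard_le_encard hroots
    _ ≤ _ := le_iSup₂_of_le fiveRootSystem isOfType_fiveRootSystem le_rfl

end Fewnomial

theorem theorem1 :
    (∀ m : ℕ, 3 ≤ m → Fewnomial.maxIsolated ![3, m] ≤ ((2 ^ m - 2 : ℕ) : ℕ∞)) ∧
    Fewnomial.maxIsolated ![3, 3] = 5 ∧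
    Fewnomial.maxIsolated ![3, 4] ≤ 14 ∧
    Fewnomial.maxIsolated ![3, 5] ≤ 30 ∧
    (∀ m : ℕ, 3 ≤ m →
      Fewnomial.maxNondegenerate ![3, m] = Fewnomial.maxIsolated ![3, m]) :=
  ⟨fun _ hm => Fewnomial.maxIsolated_le_two_pow hm,
    le_antisymm Fewnomial.maxIsolated_three_three_le Fewnomial.five_le_maxIsolated,
    Fewnomial.maxIsolated_le_two_pow (m := 4) (by norm_num),
    Fewnomial.maxIsolated_le_two_pow (m := 5) (by norm_num),
    fun _ hm => le_antisymm (Fewnomial.maxNondegenerate_le_maxIsolated _)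
      (Fewnomial.maxIsolated_le_maxNondegenerate (by omega))⟩
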